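/- For $\eta\ge 0$ and a matrix $Y\in\mathbb{R}^{n\times m}$ ($n,m\ge 1$) with columns $y_1,\dots,y_m$, let $v_\infty=(\|y_1\|_\infty,\dots,\|y_m\|_\infty)\in\mathbb{R}^m$ and let the bilevel $\ell_{1,\infty}$ projection be $$BP^{1,\infty}_\eta(Y)=\Big\{X\in\mathbb{R}^{n\times m} : \exists\,\hat u\in\arg\min_{\|u\|_1\le\eta}\|u-v_\infty\|_2\ \text{ with }\ x_j\in\arg\min_{\|x\|_\infty\le\hat u_j}\|x-y_j\|_2\ \text{ for all } j\Big\},$$ where $x_1,\dots,x_m$ are the columns of $X$. Computations are carried out on a real random access machine: a finite program (with assignments, branching, while loops and possibly recursive procedures) acts on scalar variables and arrays holding real numbers or natural-number indices; every memory access, constant, exact real operation $+,-,\times,/$, index operation $+,-$, comparison, assignment, branching and procedure call costs one step. Matrices are stored column by column. Consider the following algorithm with input $(n,m,\eta,Y)$, which runs three stages once each, one after the other. 1. Compute the column norms $v_j=\max_i|Y_{i,j}|$ by one loop over the entries of $Y$. 2. Compute $u$ from $v=(v_1,\dots,v_m)$ and $\eta$ by a subroutine for the Euclidean projection onto the $\ell_1$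 ball of radius $\eta$. 3. For $j=1,\dots,m$ and $i=1,\dots,n$, clip: $X_{i,j}=\operatorname{sign}(Y_{i,j})\min(|Y_{i,j}|,u_j)$. There are a subroutine for stage 2 and a constant $C$, both independent of $n,m,\eta$ and the data, such that for all $n,m\ge1$ and $\eta\ge0$: - stage 1 computes $v_\infty$ for every $Y\in\mathbb{R}^{n\times m}$ in at most $C\,nm$ steps; - the subroutine of stage 2 computes, for every $v\in\mathbb{R}^m$, the Euclidean projection of $v$ onto $\{u:\|u\|_1\le\eta\}$ in at most $C\,m$ steps; - stage 3 computes, for every $Y\in\mathbb{R}^{n\times m}$ and every $u\in\mathbb{R}^m$ with nonnegative entries, a matrix $X$ whose $j$-th column is the Euclidean projection of $y_j$ onto $\{x:\|x\|_\infty\le u_j\}$ for each $j$, in at most $C\,nm$ steps; - the whole algorithm halts, for every $Y\in\mathbb{R}^{n\times m}$, after at most $C\,nm$ steps, and its output $X$ is exactly the bilevel projection: $BP^{1,\infty}_\eta(Y)=\{X\}$. -/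

import Mathlib

namespace BilevelProj

noncomputable section

/-! ### The bilevel projection -/

/-- `x` is a Euclidean projection of `y` onto `S`: a minimiser of `‖z - y‖₂` over `z ∈ S`. -/
def IsProj {d : ℕ} (S : Set (EuclideanSpace ℝ (Fin d))) (y x : EuclideanSpace ℝ (Fin d)) : Prop :=
  x ∈ S ∧ ∀ z ∈ S, ‖x - y‖ ≤ ‖z - y‖

/-- The `ℓ₁` ball of radius `η` in `ℝ^d`. -/
def l1Ball (d : ℕ) (η : ℝ) : Set (EuclideanSpace ℝ (Fin d)) :=
  {u | ∑ j, |u j| ≤ η}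

/-- The `ℓ_∞` ball of radius `r` in `ℝ^d` (the norm of `Fin d → ℝ` is the sup norm). -/
def linfBall (d : ℕ) (r : ℝ) : Set (EuclideanSpace ℝ (Fin d)) :=
  {x | ‖(fun i => x i : Fin d → ℝ)‖ ≤ r}

/-- The `j`-th column of `Y`, as a Euclidean vector. -/
def column {n m : ℕ} (Y : Matrix (Fin n) (Fin m) ℝ) (j : Fin m) : EuclideanSpace ℝ (Fin n) :=
  WithLp.toLp 2 (fun i => Y i j)

/-- The vector `(‖y₁‖_∞, …, ‖y_m‖_∞)` of sup norms of the columns of `Y`. -/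
def colNorms {n m : ℕ} (Y : Matrix (Fin n) (Fin m) ℝ) : EuclideanSpace ℝ (Fin m) :=
  WithLp.toLp 2 (fun j => ‖(fun i => Y i j : Fin n → ℝ)‖)

/-- The solution set of the bilevel `ℓ_{1,∞}` problem: the matrices `X` whose columns are
projections of the columns of `Y` onto the `ℓ_∞` balls of radii `u j`, where `u` is a projection
of the vector of column norms onto the `ℓ₁` ball of radius `η`. -/
def bilevelProj {n m : ℕ} (η : ℝ) (Y : Matrix (Fin n) (Fin m) ℝ) :
    Set (Matrix (Fin n) (Fin m) ℝ) :=
  {X | ∃ u, IsProj (l1Ball m η) (colNorms Y) u ∧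
    ∀ j, IsProj (linfBall n (u j)) (column Y j) (column X j)}

/-! ### A real random access machine with unit costs

Memory consists of index (natural number) and real scalar variables and of index and real arrays.
Programs are finite `while` programs with parameterless, possibly recursive procedures.
Every memory access, arithmetic operation, comparison, assignment, branching and call costs
one step. -/

/-- Memory contents; the first argument of each field is the name of the variable or array. -/
structure Store where
  ivar : ℕ → ℕ
  rvar : ℕ → ℝ
  iarr : ℕ → ℕ → ℕ
  rarr : ℕ → ℕ → ℝ

/-- Index expressions. Subtraction is truncated at `0`. -/
inductive IExpr where
  | lit (c : ℕ)
  | var (x : ℕ)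
  | get (a : ℕ) (e : IExpr)
  | add (e₁ e₂ : IExpr)
  | sub (e₁ e₂ : IExpr)

def IExpr.eval (s : Store) : IExpr → ℕ
  | .lit c => c
  | .var x => s.ivar x
  | .get a e => s.iarr a (e.eval s)
  | .add e₁ e₂ => e₁.eval s + e₂.eval s
  | .sub e₁ e₂ => e₁.eval s - e₂.eval s

def IExpr.cost : IExpr → ℕ
  | .lit _ => 1
  | .var _ => 1
  | .get _ e => 1 + e.cost
  | .add e₁ e₂ => 1 + e₁.cost + e₂.cost
  | .sub e₁ e₂ => 1 + e₁.cost + e₂.cost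

/-- Real expressions: rational constants, memory reads and the four exact arithmetic operations.
Division by zero returns `0`. -/
inductive RExpr where
  | lit (q : ℚ)
  | var (x : ℕ)
  | get (a : ℕ) (e : IExpr)
  | neg (e : RExpr)
  | add (e₁ e₂ : RExpr)
  | sub (e₁ e₂ : RExpr)
  | mul (e₁ e₂ : RExpr)
  | div (e₁ e₂ : RExpr)

def RExpr.eval (s : Store) : RExpr → ℝ
  | .lit q => (q : ℝ)
  | .var x => s.rvar x
  | .get a e => s.rarr a (e.eval s)
  | .neg e => -e.eval s
  | .add e₁ e₂ => e₁.eval s + e₂.eval s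
  | .sub e₁ e₂ => e₁.eval s - e₂.eval s
  | .mul e₁ e₂ => e₁.eval s * e₂.eval s
  | .div e₁ e₂ => e₁.eval s / e₂.eval s

def RExpr.cost : RExpr → ℕ
  | .lit _ => 1
  | .var _ => 1
  | .get _ e => 1 + e.cost
  | .neg e => 1 + e.cost
  | .add e₁ e₂ => 1 + e₁.cost + e₂.cost
  | .sub e₁ e₂ => 1 + e₁.cost + e₂.cost
  | .mul e₁ e₂ => 1 + e₁.cost + e₂.cost
  | .div e₁ e₂ => 1 + e₁.cost + e₂.cost

/-- Tests: strict comparison of two indices or of two reals. -/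
inductive Test where
  | ilt (e₁ e₂ : IExpr)
  | rlt (e₁ e₂ : RExpr)

def Test.holds (s : Store) : Test → Prop
  | .ilt e₁ e₂ => e₁.eval s < e₂.eval s
  | .rlt e₁ e₂ => e₁.eval s < e₂.eval s

def Test.cost : Test → ℕ
  | .ilt e₁ e₂ => 1 + e₁.cost + e₂.cost
  | .rlt e₁ e₂ => 1 + e₁.cost + e₂.cost

/-- Commands. -/
inductive Cmd where
  | skip
  | iset (x : ℕ) (e : IExpr)
  | rset (x : ℕ) (e : RExpr)
  | iput (a : ℕ) (k : IExpr) (e : IExpr)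
  | rput (a : ℕ) (k : IExpr) (e : RExpr)
  | seq (c₁ c₂ : Cmd)
  | ite (b : Test) (c₁ c₂ : Cmd)
  | loop (b : Test) (c : Cmd)
  | call (p : ℕ)

/-- `Exec P c s t s'`: with the procedures `P`, the command `c` started in the store `s` halts in
the store `s'` after exactly `t` steps. `Cmd.loop b c` is "while `b` do `c`", and `Cmd.call p`
runs the `p`-th entry of the list `P`. -/
inductive Exec (P : List Cmd) : Cmd → Store → ℕ → Store → Prop where
  | skip (s : Store) : Exec P .skip s 1 s
  | iset (s : Store) (x : ℕ) (e : IExpr) :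
      Exec P (.iset x e) s (1 + e.cost) { s with ivar := Function.update s.ivar x (e.eval s) }
  | rset (s : Store) (x : ℕ) (e : RExpr) :
      Exec P (.rset x e) s (1 + e.cost) { s with rvar := Function.update s.rvar x (e.eval s) }
  | iput (s : Store) (a : ℕ) (k e : IExpr) :
      Exec P (.iput a k e) s (1 + k.cost + e.cost)
        { s with iarr := Function.update s.iarr a
                  (Function.update (s.iarr a) (k.eval s) (e.eval s)) }
  | rput (s : Store) (a : ℕ) (k : IExpr) (e : RExpr) :
      Exec P (.rput a k e) s (1 + k.cost + e.cost)
        { s with rarr := Function.update s.rarr a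
                  (Function.update (s.rarr a) (k.eval s) (e.eval s)) }
  | seq {c₁ c₂ : Cmd} {s s₁ s₂ : Store} {t₁ t₂ : ℕ} :
      Exec P c₁ s t₁ s₁ → Exec P c₂ s₁ t₂ s₂ → Exec P (.seq c₁ c₂) s (t₁ + t₂) s₂
  | ite_true {b : Test} {c₁ c₂ : Cmd} {s s' : Store} {t : ℕ} :
      b.holds s → Exec P c₁ s t s' → Exec P (.ite b c₁ c₂) s (1 + b.cost + t) s'
  | ite_false {b : Test} {c₁ c₂ : Cmd} {s s' : Store} {t : ℕ} :
      ¬ b.holds s → Exec P c₂ s t s' → Exec P (.ite b c₁ c₂) s (1 + b.cost + t) s'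
  | loop_done {b : Test} {c : Cmd} {s : Store} :
      ¬ b.holds s → Exec P (.loop b c) s (1 + b.cost) s
  | loop_step {b : Test} {c : Cmd} {s s₁ s₂ : Store} {t₁ t₂ : ℕ} :
      b.holds s → Exec P c s t₁ s₁ → Exec P (.loop b c) s₁ t₂ s₂ →
      Exec P (.loop b c) s (1 + b.cost + t₁ + t₂) s₂
  | call {p : ℕ} {c : Cmd} {s s' : Store} {t : ℕ} :
      P[p]? = some c → Exec P c s t s' → Exec P (.call p) s (1 + t) s'

/-- The machine is deterministic: final store and running time are determined by the start. -/
theorem Exec.det {P : List Cmd} {c : Cmd} {s s₁ s₂ : Store} {t₁ t₂ : ℕ}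
    (h₁ : Exec P c s t₁ s₁) (h₂ : Exec P c s t₂ s₂) : t₁ = t₂ ∧ s₁ = s₂ := by
  induction h₁ generalizing t₂ s₂ with
  | skip s => cases h₂; exact ⟨rfl, rfl⟩
  | iset s x e => cases h₂; exact ⟨rfl, rfl⟩
  | rset s x e => cases h₂; exact ⟨rfl, rfl⟩
  | iput s a k e => cases h₂; exact ⟨rfl, rfl⟩
  | rput s a k e => cases h₂; exact ⟨rfl, rfl⟩
  | seq _ _ ih₁ ih₂ =>
    cases h₂ with
    | seq g₁ g₂ =>
      obtain ⟨rfl, rfl⟩ := ih₁ g₁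
      obtain ⟨rfl, rfl⟩ := ih₂ g₂
      exact ⟨rfl, rfl⟩
  | ite_true hb _ ih =>
    cases h₂ with
    | ite_true _ g => obtain ⟨rfl, rfl⟩ := ih g; exact ⟨rfl, rfl⟩
    | ite_false hb' _ => exact absurd hb hb'
  | ite_false hb _ ih =>
    cases h₂ with
    | ite_true hb' _ => exact absurd hb' hb
    | ite_false _ g => obtain ⟨rfl, rfl⟩ := ih g; exact ⟨rfl, rfl⟩
  | loop_done hb =>
    cases h₂ with
    | loop_done _ => exact ⟨rfl, rfl⟩
    | loop_step hb' _ _ => exact absurd hb' hb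
  | loop_step hb _ _ ih₁ ih₂ =>
    cases h₂ with
    | loop_done hb' => exact absurd hb hb'
    | loop_step _ g₁ g₂ =>
      obtain ⟨rfl, rfl⟩ := ih₁ g₁
      obtain ⟨rfl, rfl⟩ := ih₂ g₂
      exact ⟨rfl, rfl⟩
  | call hp _ ih =>
    cases h₂ with
    | call hp' g =>
      rw [hp] at hp'
      obtain rfl := Option.some.inj hp'
      obtain ⟨rfl, rfl⟩ := ih g
      exact ⟨rfl, rfl⟩

/-! ### The algorithm

Names of the variables and arrays that it uses. -/

/-- Index variable holding the number `n` of rows. -/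
abbrev nVar : ℕ := 0
/-- Index variable holding the number `m` of columns. -/
abbrev mVar : ℕ := 1
/-- Row counter. -/
abbrev iVar : ℕ := 2
/-- Column counter. -/
abbrev jVar : ℕ := 3
/-- Address counter. -/
abbrev kVar : ℕ := 4
/-- Real variable holding the radius `η`. -/
abbrev etaVar : ℕ := 0
/-- Real accumulator. -/
abbrev accVar : ℕ := 1
/-- Array holding the input matrix. -/
abbrev yArr : ℕ := 0
/-- Array holding the vector of column norms. -/
abbrev vArr : ℕ := 1
/-- Array holding the `ℓ₁` projection of the vector of column norms. -/
abbrev uArr : ℕ := 2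
/-- Array holding the output matrix. -/
abbrev xArr : ℕ := 3

/-- Increment an index variable. -/
def incr (x : ℕ) : Cmd := .iset x (.add (.var x) (.lit 1))

/-- Column norms:
`k := 0; for j < m do (a := 0; for i < n do (a := max a |Y[k]|; k := k + 1); v[j] := a)`. -/
def normStage : Cmd :=
  .seq (.iset kVar (.lit 0)) <|
  .seq (.iset jVar (.lit 0)) <|
  .loop (.ilt (.var jVar) (.var mVar)) <|
    .seq (.rset accVar (.lit 0)) <|
    .seq (.iset iVar (.lit 0)) <|
    .seq (.loop (.ilt (.var iVar) (.var nVar)) <|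
      .seq (.ite (.rlt (.var accVar) (.get yArr (.var kVar)))
              (.rset accVar (.get yArr (.var kVar)))
              (.ite (.rlt (.var accVar) (.neg (.get yArr (.var kVar))))
                (.rset accVar (.neg (.get yArr (.var kVar))))
                .skip)) <|
      .seq (incr kVar) (incr iVar)) <|
    .seq (.rput vArr (.var jVar) (.var accVar)) (incr jVar)

/-- Columnwise clipping:
`k := 0; for j < m do (a := u[j]; for i < n do (X[k] := clip Y[k] to [-a, a]; k := k + 1))`. -/
def clipStage : Cmd :=
  .seq (.iset kVar (.lit 0)) <|
  .seq (.iset jVar (.lit 0)) <|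
  .loop (.ilt (.var jVar) (.var mVar)) <|
    .seq (.rset accVar (.get uArr (.var jVar))) <|
    .seq (.iset iVar (.lit 0)) <|
    .seq (.loop (.ilt (.var iVar) (.var nVar)) <|
      .seq (.ite (.rlt (.var accVar) (.get yArr (.var kVar)))
              (.rput xArr (.var kVar) (.var accVar))
              (.ite (.rlt (.get yArr (.var kVar)) (.neg (.var accVar)))
                (.rput xArr (.var kVar) (.neg (.var accVar)))
                (.rput xArr (.var kVar) (.get yArr (.var kVar))))) <|
      .seq (incr kVar) (incr iVar))
    (incr jVar)

/-- The bilevel projection algorithm with subroutine `l1` for the `ℓ₁` projection: column norms,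
then one call of `l1`, then one pass of clipping over the columns. -/
def bilevelAlg (l1 : Cmd) : Cmd := .seq normStage (.seq l1 clipStage)

/-- The vector `v` is stored in the array `a`. -/
def HoldsVec {d : ℕ} (s : Store) (a : ℕ) (v : EuclideanSpace ℝ (Fin d)) : Prop :=
  ∀ j : Fin d, s.rarr a j = v j

/-- The matrix `Y` is stored column by column in the array `a`. -/
def HoldsMat {n m : ℕ} (s : Store) (a : ℕ) (Y : Matrix (Fin n) (Fin m) ℝ) : Prop :=
  ∀ (i : Fin n) (j : Fin m), s.rarr a ((j : ℕ) * n + i) = Y i j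

end

end BilevelProj

open BilevelProj

/-! Both levels project onto closed convex sets, so minimisers are unique (`IsProj.unique`), and it
suffices that the three stages compute one admissible `u` and `X` (`bilevelProj_eq_singleton`).
Column norms and clipping are plain double loops. The substance is an `ℓ₁` projection in worst-case
linear time.

If `‖v‖₁ ≤ η`, then `v` is its own projection. Otherwise the projection is soft thresholding at the
`τ` for which the excess `∑ max (|v j| - τ) 0` equals `η` (`isProj_soft`). The excess decreases in
`τ`, so comparing it with `η` at a pivot tells on which side of the pivot `τ` lies. Entries on the
other side are settled: those below are discarded, those above enter only through their sum and
number (`Pruned`). When no entry is active, `τ` is given by a formula (`Pruned.excess_threshold`).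

Each round must settle a fixed fraction of the active entries in linear time, so the pivot is an
approximate median, found without recursion. Blocks of size `48 * d` are sorted and every fourth
entry is kept; then `d` doubles, and this repeats until fewer than eight blocks remain. The sample
shrinks by four while blocks grow by two, so the cost of the rounds halves. The ranking errors also
form a geometric series and never exceed `k / 8` for `k` active entries (`Sampled.thin`). A median
of the final sample therefore has at least `k / 8` entries on either side (`Sampled.le_count`).
Pruning keeps at most `7 / 8` of the active entries per round, and the total time is again geometric
(`runs_prune`). -/

namespace BilevelProj

/-! ### Reasoning about programs -/

/-- Started in `s`, the procedure-free command `c` halts after some number `t` of steps in some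
store `s'` with `Q t s'`. -/
def Runs (c : Cmd) (s : Store) (Q : ℕ → Store → Prop) : Prop :=
  ∃ t s', Exec [] c s t s' ∧ Q t s'

theorem Runs.mono {c : Cmd} {s : Store} {Q R : ℕ → Store → Prop} (h : Runs c s Q)
    (hQR : ∀ t s', Q t s' → R t s') : Runs c s R := by
  obtain ⟨t, s', he, hq⟩ := h
  exact ⟨t, s', he, hQR t s' hq⟩

theorem runs_skip (s : Store) (Q : ℕ → Store → Prop) : Runs .skip s Q ↔ Q 1 s := by
  constructor
  · rintro ⟨t, s', he, hq⟩; cases he; exact hq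
  · exact fun h => ⟨_, _, .skip s, h⟩

theorem runs_iset (x : ℕ) (e : IExpr) (s : Store) (Q : ℕ → Store → Prop) :
    Runs (.iset x e) s Q ↔
      Q (1 + e.cost) { s with ivar := Function.update s.ivar x (e.eval s) } := by
  constructor
  · rintro ⟨t, s', he, hq⟩; cases he; exact hq
  · exact fun h => ⟨_, _, .iset s x e, h⟩

theorem runs_rset (x : ℕ) (e : RExpr) (s : Store) (Q : ℕ → Store → Prop) :
    Runs (.rset x e) s Q ↔
      Q (1 + e.cost) { s with rvar := Function.update s.rvar x (e.eval s) } := by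
  constructor
  · rintro ⟨t, s', he, hq⟩; cases he; exact hq
  · exact fun h => ⟨_, _, .rset s x e, h⟩

theorem runs_rput (a : ℕ) (k : IExpr) (e : RExpr) (s : Store) (Q : ℕ → Store → Prop) :
    Runs (.rput a k e) s Q ↔
      Q (1 + k.cost + e.cost)
        { s with rarr := Function.update s.rarr a
                  (Function.update (s.rarr a) (k.eval s) (e.eval s)) } := by
  constructor
  · rintro ⟨t, s', he, hq⟩; cases he; exact hq
  · exact fun h => ⟨_, _, .rput s a k e, h⟩

theorem runs_seq (c₁ c₂ : Cmd) (s : Store) (Q : ℕ → Store → Prop) :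
    Runs (.seq c₁ c₂) s Q ↔
      Runs c₁ s (fun t₁ s₁ => Runs c₂ s₁ (fun t₂ s₂ => Q (t₁ + t₂) s₂)) := by
  constructor
  · rintro ⟨t, s', he, hq⟩
    cases he with
    | seq h₁ h₂ => exact ⟨_, _, h₁, _, _, h₂, hq⟩
  · rintro ⟨t₁, s₁, h₁, t₂, s₂, h₂, hq⟩
    exact ⟨_, _, .seq h₁ h₂, hq⟩

theorem runs_ite (b : Test) (c₁ c₂ : Cmd) (s : Store) (Q : ℕ → Store → Prop) :
    Runs (.ite b c₁ c₂) s Q ↔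
      (b.holds s → Runs c₁ s (fun t => Q (1 + b.cost + t))) ∧
      (¬ b.holds s → Runs c₂ s (fun t => Q (1 + b.cost + t))) := by
  constructor
  · rintro ⟨t, s', he, hq⟩
    cases he with
    | ite_true hb h => exact ⟨fun _ => ⟨_, _, h, hq⟩, fun hb' => absurd hb hb'⟩
    | ite_false hb h => exact ⟨fun hb' => absurd hb' hb, fun _ => ⟨_, _, h, hq⟩⟩
  · rintro ⟨h₁, h₂⟩
    by_cases hb : b.holds s
    · obtain ⟨t, s', h, hq⟩ := h₁ hb
      exact ⟨_, _, .ite_true hb h, hq⟩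
    · obtain ⟨t, s', h, hq⟩ := h₂ hb
      exact ⟨_, _, .ite_false hb h, hq⟩

/-- A `while` loop, with an invariant that depends on a time budget. -/
theorem runs_while {b : Test} {c : Cmd} (Inv : ℕ → Store → Prop) {Q : Store → Prop}
    (hdone : ∀ T s, Inv T s → ¬ b.holds s → 1 + b.cost ≤ T ∧ Q s)
    (hstep : ∀ T s, Inv T s → b.holds s →
      Runs c s (fun t s' => ∃ T', 1 + b.cost + t + T' ≤ T ∧ Inv T' s'))
    (T : ℕ) (s : Store) (h : Inv T s) :
    Runs (.loop b c) s (fun t s' => t ≤ T ∧ Q s') := by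
  induction T using Nat.strong_induction_on generalizing s with
  | _ T ih =>
    by_cases hb : b.holds s
    · obtain ⟨t, s', he, T', hT, hI⟩ := hstep T s h hb
      -- A test costs at least one step, so `T' < T`: the time budget doubles as the termination
      -- measure.
      obtain ⟨t₂, s₂, he₂, ht₂, hq⟩ := ih T' (by omega) s' hI
      exact ⟨_, _, .loop_step hb he he₂, by omega, hq⟩
    · obtain ⟨h₁, h₂⟩ := hdone T s h hb
      exact ⟨_, _, .loop_done hb, h₁, h₂⟩

/-- A counting loop `while x < y` whose body takes at most `T` steps and increments `x`. -/
theorem runs_for {x y : ℕ} {c : Cmd} (I : ℕ → Store → Prop) (a N T : ℕ) (s : Store)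
    (hstep : ∀ i s, i < N → I i s → s.ivar x = i → s.ivar y = N →
      Runs c s (fun t s' => t ≤ T ∧ I (i + 1) s' ∧ s'.ivar x = i + 1 ∧ s'.ivar y = N))
    (h : I a s) (hx : s.ivar x = a) (hy : s.ivar y = N) (ha : a ≤ N) :
    Runs (.loop (.ilt (.var x) (.var y)) c) s
      (fun t s' => t ≤ (N - a) * (T + 4) + 4 ∧ I N s' ∧ s'.ivar x = N ∧ s'.ivar y = N) := by
  refine runs_while
    (fun B s => ∃ i, i ≤ N ∧ B = (N - i) * (T + 4) + 4 ∧ I i s ∧ s.ivar x = i ∧ s.ivar y = N)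
    ?_ ?_ _ s ⟨a, ha, rfl, h, hx, hy⟩
  · rintro B s ⟨i, hi, rfl, hI, hx, hy⟩ hb
    simp only [Test.holds, IExpr.eval, hx, hy, not_lt] at hb
    obtain rfl := le_antisymm hi hb
    -- Branching on `x < y` costs 4 steps, once per round and once more on exit.
    simp only [Test.cost, IExpr.cost]
    exact ⟨by omega, hI, hx, hy⟩
  · rintro B s ⟨i, hi, rfl, hI, hx, hy⟩ hb
    simp only [Test.holds, IExpr.eval, hx, hy] at hb
    refine (hstep i s hb hI hx hy).mono ?_
    rintro t s' ⟨ht, hI', hx', hy'⟩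
    refine ⟨_, ?_, i + 1, hb, rfl, hI', hx', hy'⟩
    obtain ⟨r, hr⟩ : ∃ r, N - i = r + 1 := ⟨N - i - 1, by omega⟩
    have hr' : N - (i + 1) = r := by omega
    rw [hr, hr']
    simp only [Test.cost, IExpr.cost]
    nlinarith

/-! ### Variables and arrays that a command does not touch -/

/-- Index variables assigned by a command. -/
def Cmd.ivars : Cmd → List ℕ
  | .iset x _ => [x]
  | .seq c₁ c₂ => c₁.ivars ++ c₂.ivars
  | .ite _ c₁ c₂ => c₁.ivars ++ c₂.ivars
  | .loop _ c => c.ivars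
  | _ => []

/-- Real variables assigned by a command. -/
def Cmd.rvars : Cmd → List ℕ
  | .rset x _ => [x]
  | .seq c₁ c₂ => c₁.rvars ++ c₂.rvars
  | .ite _ c₁ c₂ => c₁.rvars ++ c₂.rvars
  | .loop _ c => c.rvars
  | _ => []

/-- Real arrays written by a command. -/
def Cmd.rarrs : Cmd → List ℕ
  | .rput a _ _ => [a]
  | .seq c₁ c₂ => c₁.rarrs ++ c₂.rarrs
  | .ite _ c₁ c₂ => c₁.rarrs ++ c₂.rarrs
  | .loop _ c => c.rarrs
  | _ => []

/-- The stores `s` and `s'` agree outside the variables and arrays that `c` modifies. -/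
structure Frame (c : Cmd) (s s' : Store) : Prop where
  ivar : ∀ x, x ∉ c.ivars → s'.ivar x = s.ivar x
  rvar : ∀ x, x ∉ c.rvars → s'.rvar x = s.rvar x
  rarr : ∀ a, a ∉ c.rarrs → s'.rarr a = s.rarr a

/-- Loop invariants need to mention only what the loop changes; the rest is carried over by deciding
membership in the lists of written names. Without procedures no call can run, so the lists may
ignore calls. Index arrays are left out because the programs below never use them. -/
theorem Exec.frame {c : Cmd} {s s' : Store} {t : ℕ} (h : Exec [] c s t s') : Frame c s s' := by
  induction h with
  | skip s => exact ⟨fun _ _ => rfl, fun _ _ => rfl, fun _ _ => rfl⟩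
  | iset s x e =>
    refine ⟨fun y hy => ?_, fun _ _ => rfl, fun _ _ => rfl⟩
    simp only [Cmd.ivars, List.mem_singleton] at hy
    simp [hy]
  | rset s x e =>
    refine ⟨fun _ _ => rfl, fun y hy => ?_, fun _ _ => rfl⟩
    simp only [Cmd.rvars, List.mem_singleton] at hy
    simp [hy]
  | iput s a k e => exact ⟨fun _ _ => rfl, fun _ _ => rfl, fun _ _ => rfl⟩
  | rput s a k e =>
    refine ⟨fun _ _ => rfl, fun _ _ => rfl, fun y hy => ?_⟩
    simp only [Cmd.rarrs, List.mem_singleton] at hy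
    simp [hy]
  | seq _ _ ih₁ ih₂ =>
    refine ⟨fun y hy => ?_, fun y hy => ?_, fun y hy => ?_⟩
    · simp only [Cmd.ivars, List.mem_append, not_or] at hy
      rw [ih₂.ivar y hy.2, ih₁.ivar y hy.1]
    · simp only [Cmd.rvars, List.mem_append, not_or] at hy
      rw [ih₂.rvar y hy.2, ih₁.rvar y hy.1]
    · simp only [Cmd.rarrs, List.mem_append, not_or] at hy
      rw [ih₂.rarr y hy.2, ih₁.rarr y hy.1]
  | ite_true _ _ ih =>
    refine ⟨fun y hy => ih.ivar y ?_, fun y hy => ih.rvar y ?_, fun y hy => ih.rarr y ?_⟩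
    · simp only [Cmd.ivars, List.mem_append, not_or] at hy; exact hy.1
    · simp only [Cmd.rvars, List.mem_append, not_or] at hy; exact hy.1
    · simp only [Cmd.rarrs, List.mem_append, not_or] at hy; exact hy.1
  | ite_false _ _ ih =>
    refine ⟨fun y hy => ih.ivar y ?_, fun y hy => ih.rvar y ?_, fun y hy => ih.rarr y ?_⟩
    · simp only [Cmd.ivars, List.mem_append, not_or] at hy; exact hy.2
    · simp only [Cmd.rvars, List.mem_append, not_or] at hy; exact hy.2
    · simp only [Cmd.rarrs, List.mem_append, not_or] at hy; exact hy.2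
  | loop_done _ => exact ⟨fun _ _ => rfl, fun _ _ => rfl, fun _ _ => rfl⟩
  | loop_step _ _ _ ih₁ ih₂ =>
    refine ⟨fun y hy => ?_, fun y hy => ?_, fun y hy => ?_⟩
    · rw [ih₂.ivar y hy, ih₁.ivar y hy]
    · rw [ih₂.rvar y hy, ih₁.rvar y hy]
    · rw [ih₂.rarr y hy, ih₁.rarr y hy]
  | call hp _ _ => simp at hp

theorem Runs.frame {c : Cmd} {s : Store} {Q : ℕ → Store → Prop} (h : Runs c s Q) :
    Runs c s (fun t s' => Q t s' ∧ Frame c s s') := by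
  obtain ⟨t, s', he, hq⟩ := h
  exact ⟨t, s', he, hq, he.frame⟩

attribute [simp] nVar mVar iVar jVar kVar etaVar accVar yArr vArr uArr xArr incr
attribute [simp] IExpr.eval IExpr.cost RExpr.eval RExpr.cost Test.holds Test.cost
attribute [simp] runs_skip runs_iset runs_rset runs_rput runs_seq runs_ite

/-! ### Exchange sort of a segment of the work array -/

/-- Number of entries of the array in which the pivot is searched. -/
@[simp] abbrev lenVar : ℕ := 8
/-- Block size. -/
@[simp] abbrev blockVar : ℕ := 9
/-- First index of the segment that is sorted. -/
@[simp] abbrev loVar : ℕ := 10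
/-- First index after the segment that is sorted. -/
@[simp] abbrev hiVar : ℕ := 11
/-- Outer counter of the sort. -/
@[simp] abbrev fstVar : ℕ := 12
/-- Inner counter of the sort. -/
@[simp] abbrev sndVar : ℕ := 13
/-- Temporary real variable. -/
@[simp] abbrev tmpVar : ℕ := 6
/-- Array in which the pivot is searched. -/
@[simp] abbrev bArr : ℕ := 5

/-- Exchange the entries at `fstVar` and `sndVar` if they are out of order. -/
def exchangeCmd : Cmd :=
  .ite (.rlt (.get bArr (.var sndVar)) (.get bArr (.var fstVar)))
    (.seq (.rset tmpVar (.get bArr (.var fstVar))) <|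
     .seq (.rput bArr (.var fstVar) (.get bArr (.var sndVar)))
      (.rput bArr (.var sndVar) (.var tmpVar)))
    .skip

/-- Put the minimum of the segment from `fstVar` on at the position `fstVar`. -/
def selectCmd : Cmd :=
  .seq (.iset sndVar (.add (.var fstVar) (.lit 1))) <|
  .loop (.ilt (.var sndVar) (.var hiVar)) (.seq exchangeCmd (incr sndVar))

/-- Sort the segment from `loVar` to `hiVar`. -/
def sortCmd : Cmd :=
  .seq (.iset fstVar (.var loVar)) <|
  .loop (.ilt (.var fstVar) (.var hiVar)) (.seq selectCmd (incr fstVar))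

theorem update_update_eq_comp_swap (B : ℕ → ℝ) (x y : ℕ) :
    Function.update (Function.update B x (B y)) y (B x) = B ∘ Equiv.swap x y := by
  funext z
  simp only [Function.update_apply, Function.comp, Equiv.swap_apply_def]
  split_ifs <;> simp_all

theorem runs_exchange (s : Store) {x y : ℕ} (hx : s.ivar fstVar = x) (hy : s.ivar sndVar = y) :
    Runs exchangeCmd s (fun t s' => t ≤ 20 ∧ s'.ivar = s.ivar ∧
      ((s'.rarr bArr = s.rarr bArr ∧ s.rarr bArr x ≤ s.rarr bArr y) ∨
       (s'.rarr bArr = s.rarr bArr ∘ Equiv.swap x y ∧ s.rarr bArr y ≤ s.rarr bArr x))) := by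
  simp only [fstVar, sndVar, bArr] at *
  simp [exchangeCmd, hx, hy]
  constructor
  · intro h
    right
    refine ⟨?_, h.le⟩
    rw [← update_update_eq_comp_swap]
  · intro h; left; exact h

/-- `B'` arises from `B` by permuting the entries with indices in `[lo, hi)`. -/
def PermOn (lo hi : ℕ) (B B' : ℕ → ℝ) : Prop :=
  ∃ σ : Equiv.Perm ℕ, (∀ z, z < lo ∨ hi ≤ z → σ z = z) ∧ B' = B ∘ σ

theorem PermOn.refl (lo hi : ℕ) (B : ℕ → ℝ) : PermOn lo hi B B := ⟨1, by simp, by simp⟩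

theorem PermOn.trans {lo hi : ℕ} {B B' B'' : ℕ → ℝ} (h : PermOn lo hi B B')
    (h' : PermOn lo hi B' B'') : PermOn lo hi B B'' := by
  obtain ⟨σ, hσ, rfl⟩ := h
  obtain ⟨τ, hτ, rfl⟩ := h'
  refine ⟨σ * τ, fun z hz => ?_, by funext z; simp⟩
  simp [hτ z hz, hσ z hz]

theorem PermOn.mono {lo hi lo' hi' : ℕ} {B B' : ℕ → ℝ} (h : PermOn lo hi B B')
    (hlo : lo' ≤ lo) (hhi : hi ≤ hi') : PermOn lo' hi' B B' := by
  obtain ⟨σ, hσ, rfl⟩ := h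
  exact ⟨σ, fun z hz => hσ z (by omega), rfl⟩

theorem PermOn.swap {lo hi : ℕ} (B : ℕ → ℝ) {x y : ℕ} (hx : lo ≤ x) (hx' : x < hi)
    (hy : lo ≤ y) (hy' : y < hi) : PermOn lo hi B (B ∘ Equiv.swap x y) := by
  refine ⟨Equiv.swap x y, fun z hz => ?_, rfl⟩
  apply Equiv.swap_apply_of_ne_of_ne <;> omega

theorem PermOn.eq_of_notMem {lo hi : ℕ} {B B' : ℕ → ℝ} (h : PermOn lo hi B B') {z : ℕ}
    (hz : z < lo ∨ hi ≤ z) : B' z = B z := by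
  obtain ⟨σ, hσ, rfl⟩ := h
  simp [hσ z hz]

theorem PermOn.exists_eq {lo hi : ℕ} {B B' : ℕ → ℝ} (h : PermOn lo hi B B') {z : ℕ}
    (hz : lo ≤ z) (hz' : z < hi) : ∃ w, lo ≤ w ∧ w < hi ∧ B' z = B w := by
  obtain ⟨σ, hσ, rfl⟩ := h
  refine ⟨σ z, ?_, ?_, rfl⟩
  · by_contra hc
    have := σ.injective (hσ (σ z) (by omega)); omega
  · by_contra hc
    have := σ.injective (hσ (σ z) (by omega)); omega

/-- A permutation fixing everything from `hi` on maps the indices below `hi` to themselves. Ranks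
are thus unaffected by sorting. -/
theorem PermOn.count_eq {hi : ℕ} {B B' : ℕ → ℝ} (h : PermOn 0 hi B B') (p : ℝ → Prop)
    [DecidablePred p] :
    Nat.count (fun i => p (B' i)) hi = Nat.count (fun i => p (B i)) hi := by
  obtain ⟨σ, hσ, rfl⟩ := h
  rw [Nat.count_eq_card_filter_range, Nat.count_eq_card_filter_range]
  refine Finset.card_equiv σ fun i => ?_
  simp only [Finset.mem_filter, Finset.mem_range, Function.comp]
  have : i < hi ↔ σ i < hi := by
    constructor
    · intro hi'
      by_contra hc
      have := σ.injective (hσ (σ i) (by omega)); omega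
    · intro hi'
      by_contra hc
      rw [hσ i (by omega)] at hi'; omega
  rw [this]

theorem runs_select (s : Store) {x hi : ℕ} (hx : s.ivar fstVar = x) (hhi : s.ivar hiVar = hi)
    (hxhi : x < hi) :
    Runs selectCmd s (fun t s' => t ≤ 28 * (hi - x) + 8 ∧ PermOn x hi (s.rarr bArr) (s'.rarr bArr) ∧
      ∀ z, x ≤ z → z < hi → s'.rarr bArr x ≤ s'.rarr bArr z) := by
  unfold selectCmd
  rw [runs_seq, runs_iset]
  refine (runs_for (fun y s' => x < y ∧ PermOn x hi (s.rarr bArr) (s'.rarr bArr) ∧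
    s'.ivar fstVar = x ∧ ∀ z, x ≤ z → z < y → s'.rarr bArr x ≤ s'.rarr bArr z)
    (x + 1) hi 24 _ ?_ ?_ ?_ ?_ hxhi).mono ?_
  · rintro y s₁ hy ⟨hxy, hp, hf, hm⟩ hs hh
    rw [runs_seq]
    refine (runs_exchange s₁ hf hs).mono ?_
    rintro t s₂ ⟨ht, hiv, h⟩
    simp only [incr, runs_iset]
    refine ⟨by simp; omega, ⟨by omega, ?_, by simpa [hiv] using hf, ?_⟩, by simpa [hiv] using hs,
      by simpa [hiv] using hh⟩
    · obtain ⟨h, -⟩ | ⟨h, -⟩ := h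
      · simpa [h] using hp
      · simp only [h]
        exact hp.trans (.swap _ le_rfl hxhi hxy.le hy)
    · intro z hz hzy
      obtain ⟨h, hle⟩ | ⟨h, hle⟩ := h
      · rw [h]
        obtain hzy | rfl : z < y ∨ z = y := by omega
        · exact hm z hz hzy
        · exact hle
      · rw [h]
        simp only [Function.comp, Equiv.swap_apply_left]
        by_cases hzx : z = x
        · simp [hzx]
        obtain hzy | rfl : z < y ∨ z = y := by omega
        · rw [Equiv.swap_apply_of_ne_of_ne hzx (by omega)]
          exact hle.trans (hm z hz hzy)
        · simpa using hle
  · refine ⟨by omega, .refl _ _ _, by simpa using hx, fun z hz hz' => ?_⟩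
    obtain rfl : z = x := by omega
    exact le_rfl
  · simpa using hx
  · simpa using hhi
  · rintro t s' ⟨ht, ⟨-, hp, hf, hm⟩, -⟩
    refine ⟨?_, hp, hm⟩
    simp only [IExpr.cost]; omega

/-- Quadratic time is good enough, since only blocks and the short final sample are sorted. -/
theorem runs_sort (s : Store) {lo hi : ℕ} (hlo : s.ivar loVar = lo) (hhi : s.ivar hiVar = hi)
    (hle : lo ≤ hi) :
    Runs sortCmd s (fun t s' => t ≤ 28 * (hi - lo) ^ 2 + 16 * (hi - lo) + 8 ∧
      PermOn lo hi (s.rarr bArr) (s'.rarr bArr) ∧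
      ∀ y z, lo ≤ y → y ≤ z → z < hi → s'.rarr bArr y ≤ s'.rarr bArr z) := by
  unfold sortCmd
  rw [runs_seq, runs_iset]
  refine (runs_for (fun x s' => lo ≤ x ∧ PermOn lo hi (s.rarr bArr) (s'.rarr bArr) ∧
    ∀ y z, lo ≤ y → y < x → y ≤ z → z < hi → s'.rarr bArr y ≤ s'.rarr bArr z)
    lo hi (28 * (hi - lo) + 12) _ ?_ ?_ ?_ ?_ hle).mono ?_
  · rintro x s₁ hx ⟨hlx, hp, hm⟩ hs hh
    rw [runs_seq]
    refine (runs_select s₁ hs hh hx).frame.mono ?_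
    rintro t s₂ ⟨⟨ht, hp', hm'⟩, hfr⟩
    have h₁ : s₂.ivar fstVar = x := (hfr.ivar _ (by decide)).trans hs
    have h₂ : s₂.ivar hiVar = hi := (hfr.ivar _ (by decide)).trans hh
    simp only [incr, runs_iset]
    refine ⟨by simp; omega, ⟨by omega, hp.trans (hp'.mono hlx le_rfl), ?_⟩,
      by simpa using h₁, by simpa using h₂⟩
    intro y z hy hyx hyz hz
    obtain hyx | rfl : y < x ∨ y = x := by omega
    -- Selection leaves the positions before `x` alone, and whatever it moves to `z ≥ x` came from
    -- some `w ≥ x`.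
    · rw [hp'.eq_of_notMem (Or.inl hyx)]
      by_cases hzx : z < x
      · rw [hp'.eq_of_notMem (Or.inl hzx)]
        exact hm y z hy hyx hyz hz
      · obtain ⟨w, hw, hw', e⟩ := hp'.exists_eq (not_lt.1 hzx) hz
        rw [e]
        exact hm y w hy hyx (by omega) hw'
    · exact hm' z hyz hz
  · exact ⟨le_rfl, .refl _ _ _, fun y z hy hy' => by omega⟩
  · simpa using hlo
  · simpa using hhi
  · rintro t s' ⟨ht, ⟨-, hp, hm⟩, -⟩
    refine ⟨?_, hp, fun y z hy hyz hz => hm y z hy (by omega) hyz hz⟩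
    simp only [IExpr.cost]
    nlinarith

/-! ### An approximate median in linear time -/

/-- Sort consecutive blocks of size `blockVar`, leaving out an incomplete last block. -/
def blockSortCmd : Cmd :=
  .seq (.iset loVar (.lit 0)) <|
  .seq (.iset hiVar (.var blockVar)) <|
  .loop (.ilt (.var hiVar) (.add (.var lenVar) (.lit 1))) <|
    .seq sortCmd <|
    .seq (.iset loVar (.var hiVar)) (.iset hiVar (.add (.var hiVar) (.var blockVar)))

/-- Keep every fourth of the entries before `loVar`. -/
def thinCmd : Cmd :=
  .seq (.iset fstVar (.lit 0)) <|
  .seq (.iset sndVar (.lit 0)) <|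
  .seq (.loop (.ilt (.var fstVar) (.var loVar)) <|
    .seq (.rput bArr (.var sndVar) (.get bArr (.var fstVar))) <|
    .seq (incr sndVar) (.iset fstVar (.add (.var fstVar) (.lit 4)))) <|
  .iset lenVar (.var sndVar)

theorem runs_blockSort (s : Store) {len b : ℕ} (hlen : s.ivar lenVar = len)
    (hb : s.ivar blockVar = b) (hpos : 0 < b) :
    Runs blockSortCmd s (fun t s' => t ≤ 64 * b * len + 10 ∧ ∃ J, s'.ivar loVar = J * b ∧
      J * b ≤ len ∧ len < (J + 1) * b ∧ PermOn 0 len (s.rarr bArr) (s'.rarr bArr) ∧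
      ∀ j < J, ∀ y z, j * b ≤ y → y ≤ z → z < (j + 1) * b → s'.rarr bArr y ≤ s'.rarr bArr z) := by
  unfold blockSortCmd
  simp only [runs_seq, runs_iset]
  refine (runs_while (fun T s' => ∃ J, T = 64 * b * (len - J * b) + 6 ∧ s'.ivar lenVar = len ∧
      s'.ivar blockVar = b ∧ s'.ivar loVar = J * b ∧ s'.ivar hiVar = (J + 1) * b ∧
      J * b ≤ len ∧ PermOn 0 len (s.rarr bArr) (s'.rarr bArr) ∧
      ∀ j < J, ∀ y z, j * b ≤ y → y ≤ z → z < (j + 1) * b → s'.rarr bArr y ≤ s'.rarr bArr z)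
    (Q := fun s' => ∃ J, s'.ivar loVar = J * b ∧
      J * b ≤ len ∧ len < (J + 1) * b ∧ PermOn 0 len (s.rarr bArr) (s'.rarr bArr) ∧
      ∀ j < J, ∀ y z, j * b ≤ y → y ≤ z → z < (j + 1) * b → s'.rarr bArr y ≤ s'.rarr bArr z)
    ?_ ?_ (64 * b * len + 6) _ ?_).mono ?_
  · rintro T s₁ ⟨J, rfl, h₁, h₂, h₃, h₄, h₅, h₆, h₇⟩ ht
    refine ⟨by simp, J, h₃, h₅, ?_, h₆, h₇⟩
    simp only [Test.holds, IExpr.eval, h₁, h₄] at ht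
    omega
  · rintro T s₁ ⟨J, rfl, h₁, h₂, h₃, h₄, h₅, h₆, h₇⟩ ht
    simp only [Test.holds, IExpr.eval, h₁, h₄] at ht
    have e : (J + 1) * b = J * b + b := by ring
    rw [runs_seq]
    refine (runs_sort s₁ h₃ h₄ (by omega)).frame.mono ?_
    rintro t s₂ ⟨⟨ht', hp, hm⟩, hfr⟩
    have g₁ : s₂.ivar 8 = len := (hfr.ivar _ (by decide)).trans h₁
    have g₂ : s₂.ivar 9 = b := (hfr.ivar _ (by decide)).trans h₂
    have g₄ : s₂.ivar 11 = (J + 1) * b := (hfr.ivar _ (by decide)).trans h₄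
    simp only [runs_seq, runs_iset]
    refine ⟨64 * b * (len - (J + 1) * b) + 6, ?_, J + 1, rfl, by simpa using g₁,
      by simpa using g₂, by simpa using g₄, ?_, by omega, ?_, ?_⟩
    -- Sorting a block costs `28 * b ^ 2 + 16 * b + 8` and the loop 12 more; since `1 ≤ b`, this is
    -- at most `64 * b ^ 2`.
    · have e' : (J + 1) * b - J * b = b := by omega
      rw [e'] at ht'
      obtain ⟨r, hr⟩ : ∃ r, len - J * b = r + b := ⟨len - (J + 1) * b, by omega⟩
      have hr' : len - (J + 1) * b = r := by omega
      rw [hr, hr']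
      simp only [Test.cost, IExpr.cost]
      nlinarith
    · simp [g₂, g₄]; ring
    · exact h₆.trans (hp.mono (Nat.zero_le _) (by omega))
    · intro j hj y z hy hyz hz
      obtain hj | rfl : j < J ∨ j = J := by omega
      · have : (j + 1) * b ≤ J * b := Nat.mul_le_mul_right _ hj
        change s₂.rarr bArr y ≤ s₂.rarr bArr z
        rw [hp.eq_of_notMem (Or.inl (by omega)), hp.eq_of_notMem (Or.inl (by omega))]
        exact h₇ j hj y z hy hyz hz
      · exact hm y z hy hyz hz
  · refine ⟨0, by simp, by simpa using hlen, by simpa using hb, by simp, by simpa using hb, by simp,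
      .refl _ _ _, by simp⟩
  · rintro t s' ⟨ht, h⟩
    refine ⟨?_, h⟩
    simp only [IExpr.cost]; omega

/-- Thinning in place is safe: the read position `4 * w` is never behind the write position `w`, so
entries still to be read are intact. -/
theorem runs_thin (s : Store) {N : ℕ} (hlo : s.ivar loVar = 4 * N) :
    Runs thinCmd s (fun t s' => t ≤ 17 * N + 10 ∧ s'.ivar lenVar = N ∧
      ∀ i < N, s'.rarr bArr i = s.rarr bArr (4 * i)) := by
  unfold thinCmd
  simp only [runs_seq, runs_iset]
  refine (runs_while (fun T s' => ∃ w, T = 17 * (N - w) + 4 ∧ w ≤ N ∧ s'.ivar loVar = 4 * N ∧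
      s'.ivar sndVar = w ∧ s'.ivar fstVar = 4 * w ∧
      (∀ i < w, s'.rarr bArr i = s.rarr bArr (4 * i)) ∧
      ∀ i, w ≤ i → s'.rarr bArr i = s.rarr bArr i)
    (Q := fun s' => s'.ivar sndVar = N ∧ ∀ i < N, s'.rarr bArr i = s.rarr bArr (4 * i))
    ?_ ?_ (17 * N + 4) _ ?_).mono ?_
  · rintro T s₁ ⟨w, rfl, h₁, h₂, h₃, h₄, h₅, h₆⟩ ht
    simp only [Test.holds, IExpr.eval, h₂, h₄] at ht
    obtain rfl : w = N := by omega
    exact ⟨by simp, h₃, h₅⟩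
  · rintro T s₁ ⟨w, rfl, h₁, h₂, h₃, h₄, h₅, h₆⟩ ht
    simp only [Test.holds, IExpr.eval, h₂, h₄] at ht
    simp only [loVar, sndVar, fstVar, bArr] at *
    simp only [runs_seq, runs_iset, runs_rput, incr]
    refine ⟨17 * (N - (w + 1)) + 4, by simp; omega, w + 1, rfl, by omega, by simpa using h₂,
      by simpa using h₃, by simp [h₄]; ring, fun i hi => ?_, fun i hi => ?_⟩
    · simp only [IExpr.eval, RExpr.eval, h₃, h₄, Function.update_self, Function.update_apply]
      split_ifs with hiw
      · rw [hiw, h₆ _ (by omega)]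
      · exact h₅ i (by omega)
    · simp only [IExpr.eval, RExpr.eval, h₃, h₄, Function.update_self, Function.update_apply]
      rw [if_neg (by omega)]
      exact h₆ i (by omega)
  · exact ⟨0, rfl, by simp, by simpa using hlo, by simp, by simp, by simp, fun _ _ => rfl⟩
  · rintro t s' ⟨ht, h₁, h₂⟩
    refine ⟨?_, by simpa using h₁, h₂⟩
    simp only [IExpr.cost]; omega

/-! Counting the entries that survive the thinning. -/

/-- A kept entry is the smallest of its group of four, so a lower bound on it holds for the whole
group and nothing is lost. -/
theorem four_mul_count_le_of_monotone {p : ℕ → Prop} [DecidablePred p] {m : ℕ}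
    (h : ∀ q < m, p (4 * q) → p (4 * q + 1) ∧ p (4 * q + 2) ∧ p (4 * q + 3)) :
    4 * Nat.count (fun q => p (4 * q)) m ≤ Nat.count p (4 * m) := by
  induction m with
  | zero => simp
  | succ m ih =>
    have := ih fun q hq => h q (by omega)
    have e : 4 * (m + 1) = 4 * m + 1 + 1 + 1 + 1 := by ring
    rw [e, Nat.count_succ, Nat.count_succ, Nat.count_succ, Nat.count_succ, Nat.count_succ]
    by_cases hp : p (4 * m)
    · obtain ⟨h₁, h₂, h₃⟩ := h m (by omega) hp
      simp only [hp, if_true, if_pos h₁, if_pos (show p (4 * m + 1 + 1) from h₂),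
        if_pos (show p (4 * m + 1 + 1 + 1) from h₃)]
      omega
    · simp only [hp, if_false]; omega

/-- An upper bound on a kept entry passes to the three entries before it. Only the entry at 0 has no
predecessors, which accounts for the loss of 3. -/
theorem four_mul_count_le_of_antitone {p : ℕ → Prop} [DecidablePred p] {m : ℕ}
    (h : ∀ y z, y ≤ z → z < 4 * m → p z → p y) :
    4 * Nat.count (fun q => p (4 * q)) m ≤ Nat.count p (4 * m) + 3 := by
  have key : ∀ r, r + 1 ≤ m →
      4 * Nat.count (fun q => p (4 * q)) (r + 1) ≤ Nat.count p (4 * r + 1) + 3 := by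
    intro r
    induction r with
    | zero =>
      intro _
      simp only [Nat.count_succ, Nat.count_zero]
      split_ifs <;> simp_all
    | succ r ih =>
      intro hr
      have := ih (by omega)
      have e : 4 * (r + 1) = 4 * r + 1 + 1 + 1 + 1 := by ring
      rw [Nat.count_succ, e, Nat.count_succ p (4 * r + 1 + 1 + 1 + 1), Nat.count_succ p,
        Nat.count_succ p, Nat.count_succ p]
      by_cases hp : p (4 * r + 1 + 1 + 1 + 1)
      · have h₁ := h (4 * r + 1) _ (by omega) (by omega) hp
        have h₂ := h (4 * r + 1 + 1) _ (by omega) (by omega) hp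
        have h₃ := h (4 * r + 1 + 1 + 1) _ (by omega) (by omega) hp
        rw [if_pos (e ▸ hp), if_pos h₁, if_pos h₂, if_pos h₃]
        omega
      · rw [if_neg (e ▸ hp)]; omega
  cases m with
  | zero => simp
  | succ r =>
    have := key r le_rfl
    have := Nat.count_monotone p (show 4 * r + 1 ≤ 4 * (r + 1) by omega)
    omega

/-- The number of entries `≤ a` or `≥ a` among every fourth entry of a blockwise sorted array. -/
theorem four_mul_count_thin_le {B : ℕ → ℝ} {e J : ℕ} (a : ℝ)
    (h : ∀ j < J, ∀ y z, j * (4 * e) ≤ y → y ≤ z → z < (j + 1) * (4 * e) → B y ≤ B z) :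
    4 * Nat.count (fun q => B (4 * q) ≤ a) (J * e) ≤
      Nat.count (fun i => B i ≤ a) (J * (4 * e)) + 3 * J ∧
    4 * Nat.count (fun q => a ≤ B (4 * q)) (J * e) ≤
      Nat.count (fun i => a ≤ B i) (J * (4 * e)) + 3 * J := by
  induction J with
  | zero => simp
  | succ J ih =>
    obtain ⟨ih₁, ih₂⟩ := ih fun j hj => h j (by omega)
    have hJ := h J (by omega)
    have e₁ : (J + 1) * e = J * e + e := by ring
    have e₂ : (J + 1) * (4 * e) = J * (4 * e) + 4 * e := by ring
    have e₃ : ∀ q, 4 * (J * e + q) = J * (4 * e) + 4 * q := fun q => by ring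
    rw [e₂] at hJ
    rw [e₁, e₂, Nat.count_add, Nat.count_add, Nat.count_add, Nat.count_add]
    simp only [e₃]
    have k₁ := four_mul_count_le_of_antitone (p := fun i => B (J * (4 * e) + i) ≤ a) (m := e)
      fun y z hyz hz hp => (hJ _ _ (by omega) (by omega) (by omega)).trans hp
    have k₂ := four_mul_count_le_of_monotone (p := fun i => a ≤ B (J * (4 * e) + i)) (m := e)
      fun q hq hp => ⟨hp.trans (hJ _ _ (by omega) (by omega) (by omega)),
        hp.trans (hJ _ _ (by omega) (by omega) (by omega)),
        hp.trans (hJ _ _ (by omega) (by omega) (by omega))⟩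
    constructor <;> omega

/-! ### Weighted samples and the choice of the pivot -/

/-- Number of active entries. -/
@[simp] abbrev activeVar : ℕ := 6
/-- Counter used to find the middle of an array. -/
@[simp] abbrev midVar : ℕ := 14
/-- The pivot. -/
@[simp] abbrev pivVar : ℕ := 4
/-- Array of active entries. -/
@[simp] abbrev wArr : ℕ := 4

/-- The first `len` entries of `B` are a sample with weights `d ^ 2` of the first `k` entries
of `W`, obtained by thinning out blocks of sizes less than `48 * d`. -/
structure Sampled (W : ℕ → ℝ) (k : ℕ) (B : ℕ → ℝ) (len d : ℕ) : Prop where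
  pos : 1 ≤ d
  mul_le : d ^ 2 * len ≤ k
  le_mul : k ≤ d ^ 2 * (len + 48 * d)
  large : (d = 1 ∧ len = k) ∨ 48 * d ≤ len
  -- This says `E ≤ (k / 8) * (1 - 1 / d)`, the partial sum of the errors `k / (16 * d')` over the
  -- earlier values `d' = 1, 2, 4, …` below `d`.
  count : ∃ E, 8 * d * E + k ≤ k * d ∧ ∀ a,
    d ^ 2 * Nat.count (fun i => B i ≤ a) len ≤ Nat.count (fun i => W i ≤ a) k + E ∧
    d ^ 2 * Nat.count (fun i => a ≤ B i) len ≤ Nat.count (fun i => a ≤ W i) k + E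

theorem nat_count_congr {p q : ℕ → Prop} [DecidablePred p] [DecidablePred q] {n : ℕ}
    (h : ∀ i < n, p i ↔ q i) : Nat.count p n = Nat.count q n := by
  induction n with
  | zero => simp
  | succ n ih =>
    rw [Nat.count_succ, Nat.count_succ, ih fun i hi => h i (by omega)]
    simp only [h n (by omega)]

theorem Sampled.of_eq {W B : ℕ → ℝ} {k : ℕ} (h : ∀ i < k, B i = W i) : Sampled W k B k 1 where
  pos := le_rfl
  mul_le := by simp
  le_mul := by simp
  large := Or.inl ⟨rfl, rfl⟩
  count := by
    refine ⟨0, by simp, fun a => ⟨?_, ?_⟩⟩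
    · rw [nat_count_congr (q := fun i => W i ≤ a) fun i hi => by rw [h i hi]]; simp
    · rw [nat_count_congr (q := fun i => a ≤ W i) fun i hi => by rw [h i hi]]; simp

/-- Each of the `J` blocks misjudges a rank by at most 3 entries of weight `d ^ 2`. As `48 * d ^ 3 *
J ≤ k`, the new error `3 * d ^ 2 * J` is at most `k / (16 * d)`, which is the next term of the
geometric series. -/
theorem Sampled.thin {W B B₁ B' : ℕ → ℝ} {k len d J : ℕ} (h : Sampled W k B len d)
    (hlen : 8 * (48 * d) ≤ len) (hJ : J * (48 * d) ≤ len) (hJ' : len < (J + 1) * (48 * d))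
    (hp : PermOn 0 len B B₁)
    (hs : ∀ j < J, ∀ y z, j * (48 * d) ≤ y → y ≤ z → z < (j + 1) * (48 * d) → B₁ y ≤ B₁ z)
    (hB : ∀ i < J * (12 * d), B' i = B₁ (4 * i)) :
    Sampled W k B' (J * (12 * d)) (2 * d) := by
  obtain ⟨hd, hle, hge, -, E, hE, hc⟩ := h
  -- Eight blocks leave at least `96 * d = 48 * (2 * d)` entries, as `large` demands for the doubled
  -- `d`.
  have hJ8 : 8 ≤ J := by
    by_contra hc
    have : (J + 1) * (48 * d) ≤ 8 * (48 * d) := Nat.mul_le_mul_right _ (by omega)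
    omega
  have e : 48 * d = 4 * (12 * d) := by ring
  refine ⟨by omega, ?_, ?_, Or.inr ?_, E + 3 * (d ^ 2 * J), ?_, fun a => ?_⟩
  · calc (2 * d) ^ 2 * (J * (12 * d)) = d ^ 2 * (J * (48 * d)) := by ring
      _ ≤ d ^ 2 * len := Nat.mul_le_mul_left _ hJ
      _ ≤ k := hle
  · calc k ≤ d ^ 2 * (len + 48 * d) := hge
      _ ≤ d ^ 2 * (4 * (J * (12 * d) + 48 * (2 * d))) := Nat.mul_le_mul_left _ (by nlinarith)
      _ = _ := by ring
  · nlinarith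
  · have : d ^ 2 * (J * (48 * d)) ≤ k := (Nat.mul_le_mul_left _ hJ).trans hle
    nlinarith
  · obtain ⟨hc₁, hc₂⟩ := hc a
    rw [e] at hs
    obtain ⟨k₁, k₂⟩ := four_mul_count_thin_le (e := 12 * d) a hs
    rw [nat_count_congr (p := fun i => B' i ≤ a) (q := fun q => B₁ (4 * q) ≤ a)
        fun i hi => by rw [hB i hi],
      nat_count_congr (p := fun i => a ≤ B' i) (q := fun q => a ≤ B₁ (4 * q))
        fun i hi => by rw [hB i hi]]
    rw [← e] at k₁ k₂
    have m₁ := Nat.count_monotone (fun i => B₁ i ≤ a) hJ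
    have m₂ := Nat.count_monotone (fun i => a ≤ B₁ i) hJ
    rw [hp.count_eq (fun x => x ≤ a)] at m₁
    rw [hp.count_eq (fun x => a ≤ x)] at m₂
    have n₁ := Nat.mul_le_mul_left (d ^ 2) (k₁.trans (Nat.add_le_add_right m₁ _))
    have n₂ := Nat.mul_le_mul_left (d ^ 2) (k₂.trans (Nat.add_le_add_right m₂ _))
    constructor
    · calc _ = d ^ 2 * (4 * Nat.count (fun q => B₁ (4 * q) ≤ a) (J * (12 * d))) := by ring
        _ ≤ _ := n₁
        _ ≤ _ := by rw [mul_add]; linarith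
    · calc _ = d ^ 2 * (4 * Nat.count (fun q => a ≤ B₁ (4 * q)) (J * (12 * d))) := by ring
        _ ≤ _ := n₂
        _ ≤ _ := by rw [mul_add]; linarith

theorem Sampled.le_two_mul {W B : ℕ → ℝ} {k len d : ℕ} (h : Sampled W k B len d) :
    k ≤ 2 * (d ^ 2 * len) := by
  obtain ⟨rfl, rfl⟩ | hl := h.large
  · omega
  · exact h.le_mul.trans ((Nat.mul_le_mul_left _ (Nat.add_le_add_left hl _)).trans
      (le_of_eq (by ring)))

/-- A median of the sample has at least an eighth of all entries on either side. -/
theorem Sampled.le_count {W B : ℕ → ℝ} {k len d : ℕ} (h : Sampled W k B len d) {a : ℝ}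
    (h₁ : len ≤ 2 * Nat.count (fun i => B i ≤ a) len)
    (h₂ : len ≤ 2 * Nat.count (fun i => a ≤ B i) len) :
    k ≤ 8 * Nat.count (fun i => W i ≤ a) k ∧ k ≤ 8 * Nat.count (fun i => a ≤ W i) k := by
  have hk := h.le_two_mul
  obtain ⟨hd, hle, hge, -, E, hE, hc⟩ := h
  obtain ⟨hc₁, hc₂⟩ := hc a
  have n₁ := Nat.mul_le_mul_left (d ^ 2) h₁
  have n₂ := Nat.mul_le_mul_left (d ^ 2) h₂
  have hE' : 8 * E ≤ k := by
    have : d * (8 * E) ≤ d * k := by nlinarith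
    exact Nat.le_of_mul_le_mul_left this (by omega)
  -- Half of the sample has weight at least `k / 4`, and the error takes away at most `k / 8`.
  constructor
  · nlinarith
  · nlinarith

/-- Thin out the array until it is shorter than eight blocks. -/
def sampleCmd : Cmd :=
  .loop (.ilt (.add (.add (.add (.var blockVar) (.var blockVar))
      (.add (.var blockVar) (.var blockVar))) (.add (.add (.var blockVar) (.var blockVar))
      (.add (.var blockVar) (.var blockVar)))) (.add (.var lenVar) (.lit 1))) <|
    .seq blockSortCmd <|
    .seq thinCmd (.iset blockVar (.add (.var blockVar) (.var blockVar)))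

/-- Sort the array and read off its middle entry. -/
def medianCmd : Cmd :=
  .seq (.iset loVar (.lit 0)) <|
  .seq (.iset hiVar (.var lenVar)) <|
  .seq sortCmd <|
  .seq (.iset midVar (.lit 0)) <|
  .seq (.loop (.ilt (.add (.add (.var midVar) (.var midVar)) (.lit 1)) (.var lenVar)) <|
    incr midVar) <|
  .rset pivVar (.get bArr (.var midVar))

/-- Find a pivot: an approximate median of the active entries. -/
def pivotCmd : Cmd :=
  .seq (.iset fstVar (.lit 0)) <|
  .seq (.loop (.ilt (.var fstVar) (.var activeVar)) <|
    .seq (.rput bArr (.var fstVar) (.get wArr (.var fstVar))) (incr fstVar)) <|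
  .seq (.iset lenVar (.var activeVar)) <|
  .seq (.iset blockVar (.lit 48)) <|
  .seq sampleCmd medianCmd

/-- The potential `200 * (48 * d) * len` at least halves in each round, because `d` doubles and
`len` drops to at most a quarter. The released half pays for sorting and thinning. -/
theorem runs_sample (s : Store) {W : ℕ → ℝ} {k : ℕ} (hlen : s.ivar lenVar = k)
    (hb : s.ivar blockVar = 48) (hs : Sampled W k (s.rarr bArr) k 1) :
    Runs sampleCmd s (fun t s' => t ≤ 9600 * k + 20 ∧ ∃ len d, s'.ivar lenVar = len ∧
      len < 8 * (48 * d) ∧ Sampled W k (s'.rarr bArr) len d) := by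
  unfold sampleCmd
  refine (runs_while (fun T s' => ∃ len d, T = 200 * (48 * d) * len + 20 ∧ s'.ivar lenVar = len ∧
      s'.ivar blockVar = 48 * d ∧ Sampled W k (s'.rarr bArr) len d)
    (Q := fun s' => ∃ len d, s'.ivar lenVar = len ∧
      len < 8 * (48 * d) ∧ Sampled W k (s'.rarr bArr) len d) ?_ ?_ (9600 * k + 20) s ?_)
  · rintro T s₁ ⟨len, d, rfl, h₁, h₂, h₃⟩ ht
    simp only [Test.holds, IExpr.eval, h₁, h₂] at ht
    exact ⟨by simp, len, d, h₁, by omega, h₃⟩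
  · rintro T s₁ ⟨len, d, rfl, h₁, h₂, h₃⟩ ht
    simp only [Test.holds, IExpr.eval, h₁, h₂] at ht
    have hd := h₃.pos
    rw [runs_seq]
    refine (runs_blockSort s₁ h₁ h₂ (by omega)).frame.mono ?_
    rintro t s₂ ⟨⟨ht', J, g₁, g₂, g₃, g₄, g₅⟩, hfr⟩
    have g₆ : s₂.ivar blockVar = 48 * d := (hfr.ivar _ (by decide)).trans h₂
    rw [runs_seq]
    refine (runs_thin s₂ (N := J * (12 * d)) (by rw [g₁]; ring)).frame.mono ?_
    rintro t' s₃ ⟨⟨ht'', e₁, e₂⟩, hfr'⟩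
    have e₃ : s₃.ivar 9 = 48 * d := (hfr'.ivar _ (by decide)).trans g₆
    rw [runs_iset]
    refine ⟨200 * (48 * (2 * d)) * (J * (12 * d)) + 20, ?_, J * (12 * d), 2 * d, rfl,
      by simpa using e₁, by simp [e₃]; ring, ?_⟩
    · have k₁ : 4 * (J * (12 * d)) ≤ len := le_trans (le_of_eq (by ring)) g₂
      have k₂ : 200 * (48 * (2 * d)) * (J * (12 * d)) ≤ 100 * (48 * d) * len := by nlinarith
      have k₃ : 48 * len ≤ 48 * d * len := Nat.mul_le_mul_right _ (by omega)
      simp only [Test.cost, IExpr.cost]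
      generalize 200 * (48 * (2 * d)) * (J * (12 * d)) = A at *
      have k₄ : 64 * (48 * d) * len = 64 * (48 * d * len) := by ring
      have k₅ : 100 * (48 * d) * len = 100 * (48 * d * len) := by ring
      have k₆ : 200 * (48 * d) * len = 200 * (48 * d * len) := by ring
      rw [k₄] at ht'
      rw [k₅] at k₂
      rw [k₆]
      omega
    · exact h₃.thin (by omega) g₂ g₃ g₄ g₅ e₂
  · exact ⟨k, 1, by ring, hlen, by simpa using hb, hs⟩

theorem le_nat_count_of_forall_lt {p : ℕ → Prop} [DecidablePred p] {h n : ℕ} (hn : h ≤ n)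
    (hp : ∀ i < h, p i) : h ≤ Nat.count p n := by
  have := Nat.count_monotone p hn
  rwa [Nat.count_iff_forall.2 hp] at this

theorem le_nat_count_of_forall_ge {p : ℕ → Prop} [DecidablePred p] {h n : ℕ}
    (hp : ∀ i, h ≤ i → i < n → p i) : n - h ≤ Nat.count p n := by
  obtain hn | hn := le_total n h
  · omega
  · obtain ⟨r, rfl⟩ := Nat.exists_eq_add_of_le hn
    rw [Nat.count_add, Nat.count_iff_forall.2 fun i hi => hp (h + i) (by omega) (by omega)]
    omega

theorem runs_median (s : Store) {len : ℕ} (hlen : s.ivar lenVar = len) (hpos : 0 < len) :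
    Runs medianCmd s (fun t s' => t ≤ 28 * len ^ 2 + 40 * len + 32 ∧
      len ≤ 2 * Nat.count (fun i => s.rarr bArr i ≤ s'.rvar pivVar) len ∧
      len ≤ 2 * Nat.count (fun i => s'.rvar pivVar ≤ s.rarr bArr i) len) := by
  unfold medianCmd
  simp only [runs_seq, runs_iset]
  refine (runs_sort _ (lo := 0) (hi := len) (by simp) (by simpa using hlen) hpos.le).frame.mono ?_
  rintro t₁ s₁ ⟨⟨ht, hp, hm⟩, hfr⟩
  have h₁ : s₁.ivar 8 = len := (hfr.ivar _ (by decide)).trans (by simpa using hlen)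
  -- Indices cannot be divided, so the middle `h` with `2 * h ≤ len ≤ 2 * h + 1` is found by
  -- counting.
  refine (runs_while (fun T s' => ∃ h, T = 12 * (len - h) + 8 ∧ 2 * h ≤ len ∧ s'.ivar 14 = h ∧
      s'.ivar 8 = len ∧ s'.rarr 5 = s₁.rarr 5)
    (Q := fun s' => ∃ h, 2 * h ≤ len ∧ len ≤ 2 * h + 1 ∧ s'.ivar 14 = h ∧ s'.rarr 5 = s₁.rarr 5)
    ?_ ?_ (12 * len + 8) _ ?_).mono ?_
  · rintro T s₂ ⟨h, rfl, g₁, g₂, g₃, g₄⟩ ht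
    simp [g₂, g₃] at ht
    exact ⟨by simp, h, g₁, by omega, g₂, g₄⟩
  · rintro T s₂ ⟨h, rfl, g₁, g₂, g₃, g₄⟩ ht
    simp [g₂, g₃] at ht
    simp only [incr, runs_iset]
    exact ⟨_, by simp; omega, h + 1, rfl, by omega, by simp [g₂], by simp [g₃], g₄⟩
  · exact ⟨0, by simp, by simp, by simp, by simpa using h₁, rfl⟩
  · rintro t₂ s₂ ⟨ht₂, h, g₁, g₂, g₃, g₄⟩
    rw [runs_rset]
    simp only [IExpr.eval, RExpr.eval, IExpr.cost, RExpr.cost, midVar, bArr, pivVar,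
      Function.update_self, g₃, g₄] at *
    refine ⟨?_, ?_, ?_⟩
    · simp only [Nat.sub_zero] at ht; omega
    · rw [← hp.count_eq (fun x => x ≤ s₁.rarr 5 h)]
      have := le_nat_count_of_forall_lt (p := fun i => s₁.rarr 5 i ≤ s₁.rarr 5 h) (h := h + 1)
        (n := len) (by omega) fun i hi => hm i h (by omega) (by omega) (by omega)
      omega
    · rw [← hp.count_eq (fun x => s₁.rarr 5 h ≤ x)]
      have := le_nat_count_of_forall_ge (p := fun i => s₁.rarr 5 h ≤ s₁.rarr 5 i) (h := h)
        (n := len) fun i hi hi' => hm h i (by omega) (by omega) (by omega)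
      omega

/-- The time that is allowed per active entry for finding a pivot. -/
def pivotConst : ℕ := 4300000

theorem runs_pivot (s : Store) {k : ℕ} (hk : s.ivar activeVar = k) (hpos : 0 < k) :
    Runs pivotCmd s (fun t s' => t ≤ pivotConst * k ∧
      k ≤ 8 * Nat.count (fun i => s.rarr wArr i ≤ s'.rvar pivVar) k ∧
      k ≤ 8 * Nat.count (fun i => s'.rvar pivVar ≤ s.rarr wArr i) k) := by
  unfold pivotCmd
  simp only [runs_seq, runs_iset]
  refine (runs_for (fun j s' => s'.rarr 4 = s.rarr 4 ∧ ∀ i < j, s'.rarr 5 i = s.rarr 4 i)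
    0 k 8 _ ?_ ?_ ?_ ?_ (Nat.zero_le _)).mono ?_
  · rintro j s₁ hj ⟨h₁, h₂⟩ hx hy
    simp only [fstVar, activeVar] at hx hy
    simp only [runs_seq, incr, runs_iset, runs_rput]
    refine ⟨by simp, ⟨by simpa using h₁, fun i hi => ?_⟩, by simpa using hx, by simpa using hy⟩
    simp only [bArr, wArr, fstVar, Function.update_self, IExpr.eval, RExpr.eval, hx,
      Function.update_apply, h₁]
    split_ifs with hij
    · rw [hij]
    · exact h₂ i (by omega)
  · simp
  · simp
  · simpa using hk
  · rintro t₁ s₁ ⟨ht₁, ⟨h₁, h₂⟩, h₃, h₄⟩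
    simp only [fstVar, activeVar] at h₃ h₄
    refine (runs_sample _ (W := s.rarr 4) (k := k) (by simp [h₄]) (by simp)
      (.of_eq (by exact h₂))).mono ?_
    rintro t₂ s₂ ⟨ht₂, len, d, g₁, g₂, g₃⟩
    have hlen : 0 < len := by
      by_contra hc
      obtain rfl : len = 0 := by omega
      have := g₃.le_two_mul
      omega
    refine (runs_median s₂ g₁ hlen).mono ?_
    rintro t₃ s₃ ⟨ht₃, e₁, e₂⟩
    refine ⟨?_, g₃.le_count e₁ e₂⟩
    have l₁ : len ≤ k := le_trans (Nat.le_mul_of_pos_left _ (pow_pos g₃.pos 2)) g₃.mul_le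
    have l₂ : d ^ 2 ≤ k := le_trans (Nat.le_mul_of_pos_right _ hlen) g₃.mul_le
    -- The final sample has fewer than `384 * d` entries and `d ^ 2 ≤ k`, so sorting it
    -- quadratically is linear in `k`. The factor `28 * 147456` dominates `pivotConst`.
    have l₃ : len ^ 2 ≤ 147456 * k := by
      calc len ^ 2 ≤ (8 * (48 * d)) ^ 2 := Nat.pow_le_pow_left g₂.le 2
        _ = 147456 * d ^ 2 := by ring
        _ ≤ _ := Nat.mul_le_mul_left _ l₂
    simp only [IExpr.cost, pivotConst]
    omega

/-! ### The threshold of the `ℓ₁` projection -/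

/-- The total excess of the numbers in `V` over `t`. -/
noncomputable def excess (V : Multiset ℝ) (t : ℝ) : ℝ := (V.map fun x => max (x - t) 0).sum

theorem excess_add (V V' : Multiset ℝ) (t : ℝ) : excess (V + V') t = excess V t + excess V' t := by
  simp [excess]

@[simp] theorem excess_zero (t : ℝ) : excess 0 t = 0 := by simp [excess]

theorem excess_cons (a : ℝ) (V : Multiset ℝ) (t : ℝ) :
    excess (a ::ₘ V) t = max (a - t) 0 + excess V t := by simp [excess]

theorem excess_antitone (V : Multiset ℝ) : Antitone (excess V) := fun s t h =>
  Multiset.sum_map_le_sum_map _ _ fun x _ => max_le_max (by linarith) le_rfl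

theorem excess_eq_zero {V : Multiset ℝ} {t : ℝ} (h : ∀ x ∈ V, x ≤ t) : excess V t = 0 := by
  refine Multiset.sum_eq_zero fun y hy => ?_
  obtain ⟨x, hx, rfl⟩ := Multiset.mem_map.1 hy
  exact max_eq_right (by linarith [h x hx])

theorem excess_eq_of_le {V : Multiset ℝ} {t : ℝ} (h : ∀ x ∈ V, t ≤ x) :
    excess V t = V.sum - V.card * t := by
  induction V using Multiset.induction_on with
  | empty => simp
  | cons a V ih =>
    rw [excess_cons, ih fun x hx => h x (Multiset.mem_cons_of_mem hx),
      max_eq_left (by linarith [h a (Multiset.mem_cons_self a V)])]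
    simp
    ring

/-- The numbers in `V` are split into the active ones `A`, the ones `D` below the
threshold at level `η`, and the ones `I` above it. -/
structure Pruned (η : ℝ) (V A D I : Multiset ℝ) : Prop where
  eq : V = A + D + I
  le_active : ∀ d ∈ D, ∀ a ∈ A, d ≤ a
  active_le : ∀ i ∈ I, ∀ a ∈ A, a ≤ i
  lt_excess : ∀ d ∈ D, η < excess V d
  excess_le : ∀ i ∈ I, excess V i ≤ η

/-- Evaluating the excess at a pivot touches only active entries: `D` contributes nothing, and `I`
only its sum and cardinality. -/
theorem Pruned.excess_eq {η : ℝ} {V A D I : Multiset ℝ} (h : Pruned η V A D I) {p : ℝ}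
    (hD : ∀ d ∈ D, d ≤ p) (hI : ∀ i ∈ I, p ≤ i) :
    excess V p = I.sum - I.card * p + excess A p := by
  rw [h.eq, excess_add, excess_add, excess_eq_zero hD, excess_eq_of_le hI]
  ring

/-- An excess above `η` puts the threshold above `p`. The entries equal to `p` go too, so that
progress is guaranteed even with ties; likewise in `Pruned.keep`. -/
theorem Pruned.drop {η : ℝ} {V A D I : Multiset ℝ} (h : Pruned η V A D I) {p : ℝ}
    (hp : η < excess V p) :
    Pruned η V (A.filter (p < ·)) (D + A.filter (¬ p < ·)) I where
  eq := by
    nth_rewrite 1 [h.eq, ← Multiset.filter_add_not (p < ·) A]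
    abel
  le_active := by
    intro d hd a ha
    rw [Multiset.mem_filter] at ha
    obtain hd | hd := Multiset.mem_add.1 hd
    · exact h.le_active d hd a ha.1
    · rw [Multiset.mem_filter] at hd
      linarith [ha.2, not_lt.1 hd.2]
  active_le := fun i hi a ha => h.active_le i hi a (Multiset.mem_filter.1 ha).1
  lt_excess := by
    intro d hd
    obtain hd | hd := Multiset.mem_add.1 hd
    · exact h.lt_excess d hd
    · rw [Multiset.mem_filter] at hd
      exact hp.trans_le (excess_antitone V (not_lt.1 hd.2))
  excess_le := h.excess_le

theorem Pruned.keep {η : ℝ} {V A D I : Multiset ℝ} (h : Pruned η V A D I) {p : ℝ}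
    (hp : excess V p ≤ η) :
    Pruned η V (A.filter (· < p)) D (I + A.filter (¬ · < p)) where
  eq := by
    nth_rewrite 1 [h.eq, ← Multiset.filter_add_not (· < p) A]
    abel
  active_le := by
    intro d hd a ha
    rw [Multiset.mem_filter] at ha
    obtain hd | hd := Multiset.mem_add.1 hd
    · exact h.active_le d hd a ha.1
    · rw [Multiset.mem_filter] at hd
      linarith [ha.2, not_lt.1 hd.2]
  le_active := fun i hi a ha => h.le_active i hi a (Multiset.mem_filter.1 ha).1
  excess_le := by
    intro d hd
    obtain hd | hd := Multiset.mem_add.1 hd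
    · exact h.excess_le d hd
    · rw [Multiset.mem_filter] at hd
      exact (excess_antitone V (not_lt.1 hd.2)).trans hp
  lt_excess := h.lt_excess

theorem exists_forall_le_of_ne_zero {V : Multiset ℝ} (h : V ≠ 0) : ∃ x ∈ V, ∀ y ∈ V, y ≤ x := by
  obtain ⟨x, hx, hmax⟩ := V.toFinset.exists_max_image id (by simpa using h)
  exact ⟨x, by simpa using hx, fun y hy => hmax y (by simpa using hy)⟩

theorem exists_forall_ge_of_ne_zero {V : Multiset ℝ} (h : V ≠ 0) : ∃ x ∈ V, ∀ y ∈ V, x ≤ y := by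
  obtain ⟨x, hx, hmin⟩ := V.toFinset.exists_min_image id (by simpa using h)
  exact ⟨x, by simpa using hx, fun y hy => hmin y (by simpa using hy)⟩

/-- When no number is active any more, the threshold is known. -/
theorem Pruned.excess_threshold {η : ℝ} {V D I : Multiset ℝ} (h : Pruned η V 0 D I) (hη : 0 ≤ η)
    (hV : V ≠ 0) : excess V ((I.sum - η) / I.card) = η := by
  -- Otherwise the largest element of `V` would lie in `D`, although its excess is `0 ≤ η`.
  have hI : I ≠ 0 := by
    rintro rfl
    obtain ⟨x, hx, hmax⟩ := exists_forall_le_of_ne_zero hV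
    have hxD : x ∈ D := by simpa [h.eq] using hx
    have := h.lt_excess x hxD
    rw [excess_eq_zero hmax] at this
    linarith
  have hc : (0 : ℝ) < I.card := by exact_mod_cast Multiset.card_pos.2 hI
  have hlt : ∀ d ∈ D, ∀ i ∈ I, d < i := fun d hd i hi => by
    by_contra hc
    linarith [h.lt_excess d hd, h.excess_le i hi, excess_antitone V (not_lt.1 hc)]
  -- At the minimum of `I` and at the maximum of `D` the excess is the linear function `I.sum -
  -- I.card * t`, whose value is compared with `η` by `Pruned`. This places the root of the linear
  -- equation between the two.
  have hτI : ∀ i ∈ I, (I.sum - η) / I.card ≤ i := by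
    obtain ⟨x, hx, hmin⟩ := exists_forall_ge_of_ne_zero hI
    intro i hi
    refine le_trans ?_ (hmin i hi)
    have h₁ := h.excess_le x hx
    rw [h.excess_eq (fun d hd => (hlt d hd x hx).le) hmin, excess_zero] at h₁
    rw [div_le_iff₀ hc]
    linarith
  have hτD : ∀ d ∈ D, d ≤ (I.sum - η) / I.card := by
    intro d hd
    obtain ⟨x, hx, hmax⟩ := exists_forall_le_of_ne_zero (V := D) (by rintro rfl; simp at hd)
    refine (hmax d hd).trans ?_
    have h₁ := h.lt_excess x hx
    rw [h.excess_eq hmax (fun i hi => (hlt x hx i hi).le), excess_zero] at h₁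
    rw [le_div_iff₀ hc]
    linarith
  rw [h.excess_eq hτD hτI, excess_zero]
  field_simp
  ring

/-! ### Multisets of array entries -/

/-- The multiset of the first `n` values of `f`. -/
def firstVals (f : ℕ → ℝ) (n : ℕ) : Multiset ℝ := (Multiset.range n).map f

@[simp] theorem firstVals_zero (f : ℕ → ℝ) : firstVals f 0 = 0 := by simp [firstVals]

theorem firstVals_succ (f : ℕ → ℝ) (n : ℕ) : firstVals f (n + 1) = f n ::ₘ firstVals f n := by
  simp [firstVals, Multiset.range_succ]

@[simp] theorem card_firstVals (f : ℕ → ℝ) (n : ℕ) : (firstVals f n).card = n := by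
  simp [firstVals]

theorem firstVals_congr {f g : ℕ → ℝ} {n : ℕ} (h : ∀ i < n, f i = g i) :
    firstVals f n = firstVals g n :=
  Multiset.map_congr rfl fun i hi => h i (Multiset.mem_range.1 hi)

theorem firstVals_update (f : ℕ → ℝ) (n : ℕ) (x : ℝ) :
    firstVals (Function.update f n x) (n + 1) = x ::ₘ firstVals f n := by
  rw [firstVals_succ, Function.update_self,
    firstVals_congr fun i hi => Function.update_of_ne hi.ne x f]

theorem card_filter_firstVals (p : ℝ → Prop) [DecidablePred p] (f : ℕ → ℝ) (n : ℕ) :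
    ((firstVals f n).filter p).card = Nat.count (fun i => p (f i)) n := by
  induction n with
  | zero => simp
  | succ n ih =>
    rw [firstVals_succ, Nat.count_succ]
    by_cases h : p (f n)
    · rw [Multiset.filter_cons_of_pos _ h, Multiset.card_cons, ih, if_pos h]
    · rw [Multiset.filter_cons_of_neg _ h, ih, if_neg h]; rfl

theorem sum_map_firstVals (g : ℝ → ℝ) (f : ℕ → ℝ) (n : ℕ) :
    ((firstVals f n).map g).sum = ∑ i : Fin n, g (f i) := by
  rw [firstVals, Multiset.map_map, ← Finset.sum_range fun i => g (f i)]
  rfl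

theorem exists_of_count_pos {p : ℝ → Prop} [DecidablePred p] {f : ℕ → ℝ} {n : ℕ}
    (h : 0 < Nat.count (fun i => p (f i)) n) : ∃ a ∈ firstVals f n, p a := by
  rw [← card_filter_firstVals, Multiset.card_pos_iff_exists_mem] at h
  obtain ⟨a, ha⟩ := h
  rw [Multiset.mem_filter] at ha
  exact ⟨a, ha⟩

/-! ### Pruning -/

/-- Read position. -/
@[simp] abbrev readVar : ℕ := 5
/-- Write position. -/
@[simp] abbrev writeVar : ℕ := 7
/-- Sum of the entries above the threshold. -/
@[simp] abbrev sumVar : ℕ := 2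
/-- Number of entries above the threshold. -/
@[simp] abbrev cntVar : ℕ := 3
/-- Value of the excess. -/
@[simp] abbrev valVar : ℕ := 5

/-- Compute the excess over the pivot. -/
def excessCmd : Cmd :=
  .seq (.rset valVar (.sub (.var sumVar) (.mul (.var cntVar) (.var pivVar)))) <|
  .seq (.iset readVar (.lit 0)) <|
  .loop (.ilt (.var readVar) (.var activeVar)) <|
    .seq (.ite (.rlt (.var pivVar) (.get wArr (.var readVar)))
      (.rset valVar (.add (.var valVar) (.sub (.get wArr (.var readVar)) (.var pivVar))))
      .skip) <|
    incr readVar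

/-- Remove the active entries that are not larger than the pivot. -/
def dropCmd : Cmd :=
  .seq (.iset writeVar (.lit 0)) <|
  .seq (.iset readVar (.lit 0)) <|
  .seq (.loop (.ilt (.var readVar) (.var activeVar)) <|
    .seq (.ite (.rlt (.var pivVar) (.get wArr (.var readVar)))
      (.seq (.rput wArr (.var writeVar) (.get wArr (.var readVar))) (incr writeVar))
      .skip) <|
    incr readVar) <|
  .iset activeVar (.var writeVar)

/-- Count the active entries that are not smaller than the pivot as larger than the threshold. -/
def keepCmd : Cmd :=
  .seq (.iset writeVar (.lit 0)) <|
  .seq (.iset readVar (.lit 0)) <|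
  .seq (.loop (.ilt (.var readVar) (.var activeVar)) <|
    .seq (.ite (.rlt (.get wArr (.var readVar)) (.var pivVar))
      (.seq (.rput wArr (.var writeVar) (.get wArr (.var readVar))) (incr writeVar))
      (.seq (.rset sumVar (.add (.var sumVar) (.get wArr (.var readVar))))
        (.rset cntVar (.add (.var cntVar) (.lit 1))))) <|
    incr readVar) <|
  .iset activeVar (.var writeVar)

theorem runs_excess (s : Store) {k : ℕ} (hk : s.ivar activeVar = k) :
    Runs excessCmd s (fun t s' => t ≤ 21 * k + 12 ∧
      s'.rvar valVar = s.rvar sumVar - s.rvar cntVar * s.rvar pivVar +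
        excess (firstVals (s.rarr wArr) k) (s.rvar pivVar)) := by
  unfold excessCmd
  simp only [runs_seq, runs_rset, runs_iset]
  refine (runs_for (fun j s' => s'.rarr 4 = s.rarr 4 ∧ s'.rvar 4 = s.rvar 4 ∧
      s'.rvar 5 = s.rvar 2 - s.rvar 3 * s.rvar 4 + excess (firstVals (s.rarr 4) j) (s.rvar 4))
    0 k 17 _ ?_ ?_ ?_ ?_ (Nat.zero_le _)).mono ?_
  · rintro j s₁ hj ⟨h₁, h₂, h₃⟩ hx hy
    simp only [readVar, activeVar] at hx hy
    rw [firstVals_succ, excess_cons]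
    simp [h₁, h₂, h₃, hx, hy]
    intro h
    rw [max_eq_left (by linarith)]; ring
  · simp
  · simp
  · simpa using hk
  · rintro t s' ⟨ht, ⟨h₁, h₂, h₃⟩, -⟩
    refine ⟨?_, h₃⟩
    simp only [IExpr.cost, RExpr.cost]; omega

theorem runs_drop (s : Store) {k : ℕ} (hk : s.ivar activeVar = k) :
    Runs dropCmd s (fun t s' => t ≤ 23 * k + 10 ∧
      firstVals (s'.rarr wArr) (s'.ivar activeVar) =
        (firstVals (s.rarr wArr) k).filter (s.rvar pivVar < ·)) := by
  unfold dropCmd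
  simp only [runs_seq, runs_iset]
  -- The write position never overtakes the read position `j`, so compaction in place leaves unread
  -- entries unchanged.
  refine (runs_for (fun j s' => s'.rvar 4 = s.rvar 4 ∧ s'.ivar 7 ≤ j ∧
      (∀ z, j ≤ z → s'.rarr 4 z = s.rarr 4 z) ∧
      firstVals (s'.rarr 4) (s'.ivar 7) = (firstVals (s.rarr 4) j).filter (s.rvar 4 < ·))
    0 k 19 _ ?_ ?_ ?_ ?_ (Nat.zero_le _)).mono ?_
  · rintro j s₁ hj ⟨h₁, h₂, h₃, h₄⟩ hx hy
    simp only [readVar, activeVar] at hx hy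
    rw [firstVals_succ]
    simp [h₁, hx, hy, h₃ j le_rfl]
    constructor
    · intro h
      rw [Multiset.filter_cons_of_pos _ h, firstVals_update, h₄]
      refine ⟨h₂, fun z hz => ?_, rfl⟩
      rw [Function.update_of_ne (by omega), h₃ z (by omega)]
    · intro h
      rw [Multiset.filter_cons_of_neg _ (not_lt.2 h), h₄]
      exact ⟨by omega, fun z hz => h₃ z (by omega), rfl⟩
  · simp
  · simp
  · simpa using hk
  · rintro t s' ⟨ht, ⟨h₁, h₂, h₃, h₄⟩, -⟩
    refine ⟨?_, by simpa using h₄⟩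
    simp only [IExpr.cost]; omega

theorem runs_keep (s : Store) {k : ℕ} (hk : s.ivar activeVar = k) :
    Runs keepCmd s (fun t s' => t ≤ 27 * k + 10 ∧
      firstVals (s'.rarr wArr) (s'.ivar activeVar) =
        (firstVals (s.rarr wArr) k).filter (· < s.rvar pivVar) ∧
      s'.rvar sumVar = s.rvar sumVar +
        ((firstVals (s.rarr wArr) k).filter (¬ · < s.rvar pivVar)).sum ∧
      s'.rvar cntVar = s.rvar cntVar +
        ((firstVals (s.rarr wArr) k).filter (¬ · < s.rvar pivVar)).card) := by
  unfold keepCmd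
  simp only [runs_seq, runs_iset]
  refine (runs_for (fun j s' => s'.rvar 4 = s.rvar 4 ∧ s'.ivar 7 ≤ j ∧
      (∀ z, j ≤ z → s'.rarr 4 z = s.rarr 4 z) ∧
      firstVals (s'.rarr 4) (s'.ivar 7) = (firstVals (s.rarr 4) j).filter (· < s.rvar 4) ∧
      s'.rvar 2 = s.rvar 2 + ((firstVals (s.rarr 4) j).filter (¬ · < s.rvar 4)).sum ∧
      s'.rvar 3 = s.rvar 3 + ((firstVals (s.rarr 4) j).filter (¬ · < s.rvar 4)).card)
    0 k 23 _ ?_ ?_ ?_ ?_ (Nat.zero_le _)).mono ?_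
  · rintro j s₁ hj ⟨h₁, h₂, h₃, h₄, h₅, h₆⟩ hx hy
    simp only [readVar, activeVar] at hx hy
    rw [firstVals_succ]
    simp only [runs_seq, runs_iset, runs_ite, runs_rput, runs_rset, incr, Test.holds, RExpr.eval,
      IExpr.eval, wArr, readVar, pivVar, hx, h₁, h₃ j le_rfl]
    constructor
    · intro h
      simp only [Multiset.filter_cons_of_pos (p := fun x => x < s.rvar 4) _ h,
        Multiset.filter_cons_of_neg (p := fun x => ¬ x < s.rvar 4) _ (not_not.2 h)]
      simp only [writeVar, activeVar, Function.update_self, firstVals_update, h₄,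
        Function.update_of_ne (show (7 : ℕ) ≠ 5 by decide),
        Function.update_of_ne (show (6 : ℕ) ≠ 5 by decide),
        Function.update_of_ne (show (6 : ℕ) ≠ 7 by decide),
        Function.update_of_ne (show (5 : ℕ) ≠ 7 by decide)]
      refine ⟨by simp, ⟨trivial, by omega, fun z hz => ?_, trivial, h₅, h₆⟩,
        by simp [hx], by simp [hy]⟩
      rw [Function.update_of_ne (by omega), h₃ z (by omega)]
    · intro h
      simp only [Multiset.filter_cons_of_neg (p := fun x => x < s.rvar 4) _ h,
        Multiset.filter_cons_of_pos (p := fun x => ¬ x < s.rvar 4) _ h]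
      refine ⟨by simp, ⟨by simp [h₁], by simp; omega, fun z hz => h₃ z (by omega),
        by simpa using h₄, ?_, ?_⟩, by simp, by simp [hy]⟩
      · simp [h₅, -not_lt]; ring
      · simp [h₆, -not_lt]; ring
  · simp
  · simp
  · simpa using hk
  · rintro t s' ⟨ht, ⟨h₁, h₂, h₃, h₄, h₅, h₆⟩, -⟩
    refine ⟨?_, by simpa using h₄, h₅, h₆⟩
    simp only [IExpr.cost]; omega

/-- The threshold. -/
@[simp] abbrev tauVar : ℕ := 7

/-- Find the threshold by pruning the active entries. -/
def pruneCmd : Cmd :=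
  .loop (.ilt (.lit 0) (.var activeVar)) <|
    .seq pivotCmd <|
    .seq excessCmd <|
    .ite (.rlt (.var etaVar) (.var valVar)) dropCmd keepCmd

/-- A round with `r` active entries costs at most `(pivotConst + 100) * r` and leaves at most `7 * r
/ 8`, whence the factor 8 of the geometric series. -/
theorem runs_prune (s : Store) {η : ℝ} {k : ℕ} (hη : s.rvar etaVar = η)
    (hk : s.ivar activeVar = k) (hS : s.rvar sumVar = 0) (hc : s.rvar cntVar = 0) :
    Runs pruneCmd s (fun t s' => t ≤ 8 * (pivotConst + 100) * k + 4 ∧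
      ∃ D I, Pruned η (firstVals (s.rarr wArr) k) 0 D I ∧ s'.rvar sumVar = I.sum ∧
        s'.rvar cntVar = I.card) := by
  unfold pruneCmd
  refine runs_while (fun T s' => T = 8 * (pivotConst + 100) * s'.ivar activeVar + 4 ∧
      s'.rvar etaVar = η ∧
      ∃ D I, Pruned η (firstVals (s.rarr wArr) k)
        (firstVals (s'.rarr wArr) (s'.ivar activeVar)) D I ∧ s'.rvar sumVar = I.sum ∧
        s'.rvar cntVar = I.card)
    (Q := fun s' => ∃ D I, Pruned η (firstVals (s.rarr wArr) k) 0 D I ∧ s'.rvar sumVar = I.sum ∧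
        s'.rvar cntVar = I.card) ?_ ?_ _ s ?_
  · rintro T s₁ ⟨rfl, h₁, D, I, h₂, h₃, h₄⟩ ht
    simp only [Test.holds, IExpr.eval, not_lt, Nat.le_zero] at ht
    rw [ht, firstVals_zero] at h₂
    exact ⟨by simp, D, I, h₂, h₃, h₄⟩
  · rintro T s₁ ⟨rfl, h₁, D, I, h₂, h₃, h₄⟩ ht
    simp only [Test.holds, IExpr.eval] at ht
    obtain ⟨r, hr⟩ : ∃ r, s₁.ivar activeVar = r := ⟨_, rfl⟩
    rw [hr] at ht h₂ ⊢
    rw [runs_seq]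
    refine (runs_pivot s₁ hr ht).frame.mono ?_
    rintro t₁ s₂ ⟨⟨ht₁, c₁, c₂⟩, hf₁⟩
    rw [runs_seq]
    refine (runs_excess s₂ (k := r) ((hf₁.ivar _ (by decide)).trans hr)).frame.mono ?_
    rintro t₂ s₃ ⟨⟨ht₂, hv⟩, hf₂⟩
    have hW₂ : s₂.rarr wArr = s₁.rarr wArr := hf₁.rarr _ (by decide)
    have hW₃ : s₃.rarr wArr = s₁.rarr wArr := (hf₂.rarr _ (by decide)).trans hW₂
    have hS₂ : s₂.rvar sumVar = I.sum := (hf₁.rvar _ (by decide)).trans h₃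
    have hS₃ : s₃.rvar sumVar = I.sum := (hf₂.rvar _ (by decide)).trans hS₂
    have hc₂ : s₂.rvar cntVar = I.card := (hf₁.rvar _ (by decide)).trans h₄
    have hc₃ : s₃.rvar cntVar = I.card := (hf₂.rvar _ (by decide)).trans hc₂
    have hη₃ : s₃.rvar etaVar = η :=
      (hf₂.rvar _ (by decide)).trans ((hf₁.rvar _ (by decide)).trans h₁)
    have hp₃ : s₃.rvar pivVar = s₂.rvar pivVar := hf₂.rvar _ (by decide)
    have hk₃ : s₃.ivar activeVar = r :=
      (hf₂.ivar _ (by decide)).trans ((hf₁.ivar _ (by decide)).trans hr)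
    generalize s₂.rvar pivVar = p at *
    -- The pivot lies between two active entries, hence above `D` and below `I`; this is what
    -- `Pruned.excess_eq` needs.
    obtain ⟨a₁, ha₁, ha₁p⟩ := exists_of_count_pos (p := fun x => x ≤ p) (f := s₁.rarr wArr)
      (n := r) (by omega)
    obtain ⟨a₂, ha₂, ha₂p⟩ := exists_of_count_pos (p := fun x => p ≤ x) (f := s₁.rarr wArr)
      (n := r) (by omega)
    rw [hS₂, hc₂, hW₂, ← h₂.excess_eq (fun d hd => (h₂.le_active d hd a₁ ha₁).trans ha₁p)
      (fun i hi => ha₂p.trans (h₂.active_le i hi a₂ ha₂))] at hv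
    rw [← card_filter_firstVals (fun x => x ≤ p)] at c₁
    rw [← card_filter_firstVals (fun x => p ≤ x)] at c₂
    have hcard := card_firstVals (s₁.rarr wArr) r
    rw [runs_ite]
    simp only [Test.holds, RExpr.eval, hη₃, hv]
    constructor
    · intro hlt
      refine (runs_drop s₃ hk₃).frame.mono ?_
      rintro t₃ s₄ ⟨⟨ht₃, hw⟩, hf₃⟩
      rw [hW₃, hp₃] at hw
      have e : s₄.ivar activeVar + ((firstVals (s₁.rarr wArr) r).filter (· ≤ p)).card = r := by
        rw [← card_firstVals (s₄.rarr wArr) (s₄.ivar activeVar), hw, ← Multiset.card_add]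
        conv_rhs => rw [← hcard, ← Multiset.filter_add_not (p < ·) (firstVals (s₁.rarr wArr) r)]
        simp only [not_lt]
      refine ⟨_, ?_, rfl, (hf₃.rvar _ (by decide)).trans hη₃, _, I, hw ▸ h₂.drop hlt,
        (hf₃.rvar _ (by decide)).trans hS₃, (hf₃.rvar _ (by decide)).trans hc₃⟩
      simp only [Test.cost, IExpr.cost, RExpr.cost]
      have : (pivotConst + 100) * (8 * s₄.ivar activeVar + r) ≤ (pivotConst + 100) * (8 * r) :=
        Nat.mul_le_mul_left _ (by omega)
      nlinarith
    · intro hlt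
      refine (runs_keep s₃ hk₃).frame.mono ?_
      rintro t₃ s₄ ⟨⟨ht₃, hw, hS, hc⟩, hf₃⟩
      rw [hW₃, hp₃] at hw hS hc
      have e : s₄.ivar activeVar + ((firstVals (s₁.rarr wArr) r).filter (p ≤ ·)).card = r := by
        rw [← card_firstVals (s₄.rarr wArr) (s₄.ivar activeVar), hw, ← Multiset.card_add]
        conv_rhs => rw [← hcard, ← Multiset.filter_add_not (· < p) (firstVals (s₁.rarr wArr) r)]
        simp only [not_lt]
      refine ⟨_, ?_, rfl, (hf₃.rvar _ (by decide)).trans hη₃, D, _, hw ▸ h₂.keep (not_lt.1 hlt),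
        by rw [hS, hS₃, Multiset.sum_add], by rw [hc, hc₃, Multiset.card_add, Nat.cast_add]⟩
      simp only [Test.cost, IExpr.cost, RExpr.cost]
      have : (pivotConst + 100) * (8 * s₄.ivar activeVar + r) ≤ (pivotConst + 100) * (8 * r) :=
        Nat.mul_le_mul_left _ (by omega)
      nlinarith
  · exact ⟨by rw [hk], hη, 0, 0, ⟨by simp [hk], by simp, by simp, by simp, by simp⟩,
      by simpa using hS, by simpa using hc⟩

/-! ### The `ℓ₁` projection -/

/-- Soft thresholding. -/
noncomputable def soft (τ x : ℝ) : ℝ := if τ < x then x - τ else if x < -τ then x + τ else 0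

theorem abs_soft {τ : ℝ} (hτ : 0 ≤ τ) (x : ℝ) : |soft τ x| = max (|x| - τ) 0 := by
  unfold soft
  split_ifs with h₁ h₂
  · rw [abs_of_pos (by linarith), abs_of_pos (a := x) (by linarith), max_eq_left (by linarith)]
  · rw [abs_of_neg (by linarith), abs_of_neg (a := x) (by linarith), max_eq_left (by linarith)]
    ring
  · rw [abs_zero, max_eq_right]
    linarith [abs_le.2 ⟨not_lt.1 h₂, not_lt.1 h₁⟩]

/-- Together with `sub_soft_mul_soft` this says that `x - soft τ x` is `τ` times a subgradient of
the absolute value at `soft τ x`, the optimality condition with multiplier `τ`. -/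
theorem sub_soft_mul_le {τ : ℝ} (hτ : 0 ≤ τ) (x z : ℝ) : (x - soft τ x) * z ≤ τ * |z| := by
  have h : |x - soft τ x| ≤ τ := by
    unfold soft
    split_ifs with h₁ h₂
    · rw [sub_sub_cancel, abs_of_nonneg hτ]
    · rw [sub_add_cancel_left, abs_neg, abs_of_nonneg hτ]
    · rw [sub_zero]; exact abs_le.2 ⟨not_lt.1 h₂, not_lt.1 h₁⟩
  calc (x - soft τ x) * z ≤ |(x - soft τ x) * z| := le_abs_self _
    _ = |x - soft τ x| * |z| := abs_mul _ _
    _ ≤ τ * |z| := mul_le_mul_of_nonneg_right h (abs_nonneg z)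

theorem sub_soft_mul_soft (τ x : ℝ) :
    (x - soft τ x) * soft τ x = τ * |soft τ x| := by
  unfold soft
  split_ifs with h₁ h₂
  · rw [abs_of_pos (by linarith)]; ring
  · rw [abs_of_neg (by linarith)]; ring
  · simp

theorem soft_zero (x : ℝ) : soft 0 x = x := by
  unfold soft
  split_ifs with h₁ h₂
  · simp
  · simp
  · linarith

/-- Soft thresholding gives the projection onto the `ℓ₁` ball, if the threshold is right. -/
theorem isProj_soft {m : ℕ} {η τ : ℝ} (v : EuclideanSpace ℝ (Fin m)) (hτ : 0 ≤ τ)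
    (h : ∑ j, |soft τ (v j)| = η) :
    IsProj (l1Ball m η) v (WithLp.toLp 2 fun j => soft τ (v j)) := by
  refine ⟨h.le, fun z hz => ?_⟩
  set u : EuclideanSpace ℝ (Fin m) := WithLp.toLp 2 fun j => soft τ (v j) with hu
  have hz' : ∑ j, |z j| ≤ η := hz
  -- The variational inequality of the projection: `v - u` pairs with `z` to at most `τ * η`, and
  -- with `u` to exactly `τ * η`.
  have h₁ : ∑ j, (z j - u j) * (u j - v j) ≥ 0 := by
    have e₁ : ∑ j, (v j - soft τ (v j)) * z j ≤ τ * η :=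
      (Finset.sum_le_sum fun j _ => sub_soft_mul_le hτ (v j) (z j)).trans (by
        rw [← Finset.mul_sum]; exact mul_le_mul_of_nonneg_left hz' hτ)
    have e₂ : ∑ j, (v j - soft τ (v j)) * soft τ (v j) = τ * η := by
      rw [← h, Finset.mul_sum]
      exact Finset.sum_congr rfl fun j _ => sub_soft_mul_soft τ (v j)
    have e₃ : ∑ j, (z j - u j) * (u j - v j) = ∑ j, (v j - soft τ (v j)) * soft τ (v j) -
        ∑ j, (v j - soft τ (v j)) * z j := by
      rw [← Finset.sum_sub_distrib]
      refine Finset.sum_congr rfl fun j _ => ?_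
      simp only [hu]; ring
    rw [e₃]; linarith
  refine (pow_le_pow_iff_left₀ (norm_nonneg _) (norm_nonneg _) two_ne_zero).1 ?_
  simp only [EuclideanSpace.norm_sq_eq, Real.norm_eq_abs, sq_abs, PiLp.sub_apply]
  have h₂ : ∑ j, (z j - v j) ^ 2 = ∑ j, (z j - u j) ^ 2 + ∑ j, (u j - v j) ^ 2 +
      2 * ∑ j, (z j - u j) * (u j - v j) := by
    rw [Finset.mul_sum, ← Finset.sum_add_distrib, ← Finset.sum_add_distrib]
    exact Finset.sum_congr rfl fun j _ => by ring
  have h₃ : 0 ≤ ∑ j, (z j - u j) ^ 2 := Finset.sum_nonneg fun j _ => sq_nonneg _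
  linarith

/-- Store the absolute values of the input and compute their sum. -/
def absCmd : Cmd :=
  .seq (.rset valVar (.lit 0)) <|
  .seq (.iset readVar (.lit 0)) <|
  .loop (.ilt (.var readVar) (.var mVar)) <|
    .seq (.ite (.rlt (.get vArr (.var readVar)) (.lit 0))
      (.rput wArr (.var readVar) (.neg (.get vArr (.var readVar))))
      (.rput wArr (.var readVar) (.get vArr (.var readVar)))) <|
    .seq (.rset valVar (.add (.var valVar) (.get wArr (.var readVar)))) <|
    incr readVar

/-- Compute the threshold. -/
def thresholdCmd : Cmd :=
  .seq (.rset tauVar (.lit 0)) <|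
  .ite (.rlt (.var etaVar) (.var valVar))
    (.seq (.rset sumVar (.lit 0)) <|
     .seq (.rset cntVar (.lit 0)) <|
     .seq (.iset activeVar (.var mVar)) <|
     .seq pruneCmd <|
     .rset tauVar (.div (.sub (.var sumVar) (.var etaVar)) (.var cntVar)))
    .skip

/-- Soft thresholding of the input. -/
def softCmd : Cmd :=
  .seq (.iset readVar (.lit 0)) <|
  .loop (.ilt (.var readVar) (.var mVar)) <|
    .seq (.ite (.rlt (.var tauVar) (.get vArr (.var readVar)))
      (.rput uArr (.var readVar) (.sub (.get vArr (.var readVar)) (.var tauVar)))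
      (.ite (.rlt (.get vArr (.var readVar)) (.neg (.var tauVar)))
        (.rput uArr (.var readVar) (.add (.get vArr (.var readVar)) (.var tauVar)))
        (.rput uArr (.var readVar) (.lit 0)))) <|
    incr readVar

/-- The projection onto the `ℓ₁` ball. -/
def l1Cmd : Cmd := .seq absCmd (.seq thresholdCmd softCmd)

theorem runs_abs (s : Store) {m : ℕ} (hm : s.ivar mVar = m) :
    Runs absCmd s (fun t s' => t ≤ 30 * m + 10 ∧
      (∀ i < m, s'.rarr wArr i = |s.rarr vArr i|) ∧
      s'.rvar valVar = (firstVals (s'.rarr wArr) m).sum) := by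
  unfold absCmd
  simp only [runs_seq, runs_rset, runs_iset]
  refine (runs_for (fun j s' => s'.rarr 1 = s.rarr 1 ∧ (∀ i < j, s'.rarr 4 i = |s.rarr 1 i|) ∧
      s'.rvar 5 = (firstVals (s'.rarr 4) j).sum)
    0 m 26 _ ?_ ?_ ?_ ?_ (Nat.zero_le _)).mono ?_
  · rintro j s₁ hj ⟨h₁, h₂, h₃⟩ hx hy
    simp only [readVar, mVar] at hx hy
    have key : ∀ x : ℝ, (firstVals (Function.update (s₁.rarr 4) j x) (j + 1)).sum =
        s₁.rvar 5 + x := fun x => by rw [firstVals_update, Multiset.sum_cons, h₃, add_comm]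
    have key' : ∀ x : ℝ, x = |s.rarr 1 j| → ∀ i ≤ j,
        Function.update (s₁.rarr 4) j x i = |s.rarr 1 i| := by
      intro x hx i hi
      rw [Function.update_apply]
      split_ifs with hij
      · rw [hx, hij]
      · exact h₂ i (by omega)
    simp [h₁, hx, hy, key]
    exact ⟨fun h => key' _ (abs_of_neg h).symm, fun h => key' _ (abs_of_nonneg h).symm⟩
  · simp
  · simp
  · simpa using hm
  · rintro t s' ⟨ht, ⟨h₁, h₂, h₃⟩, -⟩
    refine ⟨?_, h₂, h₃⟩
    simp only [IExpr.cost, RExpr.cost]; omega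

theorem runs_threshold (s : Store) {m : ℕ} {η : ℝ} (hm : s.ivar mVar = m) (hη : s.rvar etaVar = η)
    (hη0 : 0 ≤ η) (hv : s.rvar valVar = (firstVals (s.rarr wArr) m).sum)
    (h0 : ∀ i < m, 0 ≤ s.rarr wArr i) :
    Runs thresholdCmd s (fun t s' => t ≤ 8 * (pivotConst + 100) * m + 30 ∧ 0 ≤ s'.rvar tauVar ∧
      ((s'.rvar tauVar = 0 ∧ (firstVals (s.rarr wArr) m).sum ≤ η) ∨
        excess (firstVals (s.rarr wArr) m) (s'.rvar tauVar) = η)) := by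
  simp only [mVar, etaVar, valVar] at hm hη hv
  unfold thresholdCmd
  simp only [runs_seq, runs_rset, runs_ite]
  constructor
  · intro h
    simp [hη, hv] at h
    rw [runs_iset]
    refine (runs_prune _ (η := η) (k := m) (by simpa using hη) (by simpa using hm) (by simp)
      (by simp)).frame.mono ?_
    rintro t s' ⟨⟨ht, D, I, hp, hS, hc⟩, hfr⟩
    have hη' : s'.rvar 0 = η := (hfr.rvar _ (by decide)).trans (by simpa using hη)
    simp only [wArr] at hp
    have hx := hp.excess_threshold hη0 (by rintro h'; rw [h', Multiset.sum_zero] at h; linarith)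
    have h0' : excess (firstVals (s.rarr 4) m) 0 = (firstVals (s.rarr 4) m).sum := by
      rw [excess_eq_of_le]
      · simp
      · intro x hx
        obtain ⟨i, hi, rfl⟩ := Multiset.mem_map.1 hx
        exact h0 i (Multiset.mem_range.1 hi)
    simp only [sumVar, cntVar] at hS hc
    refine ⟨?_, ?_, ?_⟩
    · simp only [Test.cost, IExpr.cost, RExpr.cost]; omega
    · simp [hS, hc, hη']
      -- A negative threshold would have excess at least the excess at 0, which is the full sum and
      -- exceeds `η`.
      by_contra hneg
      have := excess_antitone (firstVals (s.rarr 4) m) (not_le.1 hneg).le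
      rw [hx, h0'] at this
      linarith
    · right
      simpa [hS, hc, hη'] using hx
  · intro h
    simp [hη, hv] at h
    simp [h]

theorem runs_soft (s : Store) {m : ℕ} (hm : s.ivar mVar = m) :
    Runs softCmd s (fun t s' => t ≤ 30 * m + 10 ∧
      ∀ i < m, s'.rarr uArr i = soft (s.rvar tauVar) (s.rarr vArr i)) := by
  unfold softCmd
  simp only [runs_seq, runs_iset]
  refine (runs_for (fun j s' => s'.rarr 1 = s.rarr 1 ∧ s'.rvar 7 = s.rvar 7 ∧
      (∀ i < j, s'.rarr 2 i = soft (s.rvar 7) (s.rarr 1 i)))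
    0 m 26 _ ?_ ?_ ?_ ?_ (Nat.zero_le _)).mono ?_
  · rintro j s₁ hj ⟨h₁, h₂, h₃⟩ hx hy
    simp only [readVar, mVar] at hx hy
    have key : ∀ x : ℝ, x = soft (s.rvar 7) (s.rarr 1 j) → ∀ i ≤ j,
        Function.update (s₁.rarr 2) j x i = soft (s.rvar 7) (s.rarr 1 i) := by
      intro x hx i hi
      rw [Function.update_apply]
      split_ifs with hij
      · rw [hx, hij]
      · exact h₃ i (by omega)
    simp [h₁, h₂, hx, hy]
    refine ⟨fun h => key _ ?_, fun h => ⟨fun h' => key _ ?_, fun h' => key _ ?_⟩⟩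
    · rw [soft, if_pos h]
    · rw [soft, if_neg (not_lt.2 h), if_pos h']
    · rw [soft, if_neg (not_lt.2 h), if_neg (not_lt.2 h')]
  · simp
  · simp
  · simpa using hm
  · rintro t s' ⟨ht, ⟨h₁, h₂, h₃⟩, -⟩
    refine ⟨?_, h₃⟩
    simp only [IExpr.cost]; omega

/-- The projection onto the `ℓ₁` ball is computed in linear time. -/
theorem runs_l1 (s : Store) {m : ℕ} {η : ℝ} (v : EuclideanSpace ℝ (Fin m)) (hpos : 0 < m)
    (hη0 : 0 ≤ η) (hm : s.ivar mVar = m) (hη : s.rvar etaVar = η) (hv : HoldsVec s vArr v) :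
    Runs l1Cmd s (fun t s' => t ≤ 9 * (pivotConst + 100) * m ∧
      ∃ u, HoldsVec s' uArr u ∧ IsProj (l1Ball m η) v u) := by
  unfold l1Cmd
  rw [runs_seq]
  refine (runs_abs s hm).frame.mono ?_
  rintro t₁ s₁ ⟨⟨ht₁, h₁, h₂⟩, hf₁⟩
  rw [runs_seq]
  have hm₁ : s₁.ivar mVar = m := (hf₁.ivar _ (by decide)).trans hm
  refine (runs_threshold s₁ hm₁ ((hf₁.rvar _ (by decide)).trans hη) hη0 h₂
    fun i hi => by rw [h₁ i hi]; exact abs_nonneg _).frame.mono ?_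
  rintro t₂ s₂ ⟨⟨ht₂, hτ, h₃⟩, hf₂⟩
  refine (runs_soft s₂ ((hf₂.ivar _ (by decide)).trans hm₁)).mono ?_
  rintro t₃ s₃ ⟨ht₃, h₄⟩
  generalize s₂.rvar tauVar = τ at *
  have hv₂ : s₂.rarr vArr = s.rarr vArr :=
    (hf₂.rarr _ (by decide)).trans (hf₁.rarr _ (by decide))
  refine ⟨?_, WithLp.toLp 2 fun j => soft τ (v j), fun j => ?_, ?_⟩
  · simp only [pivotConst] at *; omega
  · rw [h₄ j j.2, hv₂, hv j]
  · have hW : ∀ j : Fin m, s₁.rarr wArr j = |v j| := fun j => by rw [h₁ j j.2, hv j]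
    obtain ⟨rfl, hle⟩ | hex := h₃
    · simp only [soft_zero]
      refine ⟨?_, fun z _ => by simp⟩
      have := sum_map_firstVals id (s₁.rarr wArr) m
      rw [Multiset.map_id] at this
      rw [this] at hle
      simpa [l1Ball, hW] using hle
    · refine isProj_soft v hτ ?_
      rw [excess, sum_map_firstVals] at hex
      simpa [hW, abs_soft hτ] using hex

/-! ### Column norms and clipping -/

theorem runs_normStage (s : Store) {n m : ℕ} (Y : Matrix (Fin n) (Fin m) ℝ) (hn : 0 < n)
    (hm : 0 < m) (hsn : s.ivar nVar = n) (hsm : s.ivar mVar = m) (hY : HoldsMat s yArr Y) :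
    Runs normStage s (fun t s' => t ≤ 60 * (n * m) ∧ HoldsVec s' vArr (colNorms Y)) := by
  simp only [nVar, mVar, yArr] at hsn hsm hY
  unfold normStage
  simp only [runs_seq, runs_iset]
  refine (runs_for (fun j s' => s'.rarr 0 = s.rarr 0 ∧ s'.ivar 0 = n ∧ s'.ivar 4 = j * n ∧
      ∀ j' : Fin m, (j' : ℕ) < j → s'.rarr 1 j' = ‖(fun i => Y i j' : Fin n → ℝ)‖)
    0 m (27 * n + 15) _ ?_ ?_ ?_ ?_ (Nat.zero_le _)).mono ?_
  · rintro j s₁ hj ⟨h₁, h₂, h₃, h₄⟩ hx hy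
    simp only [jVar, mVar] at hx hy
    simp only [runs_seq, runs_iset, runs_rset]
    -- The accumulator is nonnegative, bounds the entries read so far, and is 0 or attained.
    -- Together these make it the sup norm.
    refine (runs_for (fun i s' => s'.rarr 0 = s.rarr 0 ∧ s'.rarr 1 = s₁.rarr 1 ∧
        s'.ivar 1 = m ∧ s'.ivar 3 = j ∧ s'.ivar 4 = j * n + i ∧ 0 ≤ s'.rvar 1 ∧
        (∀ i' < i, |s.rarr 0 (j * n + i')| ≤ s'.rvar 1) ∧
        (s'.rvar 1 = 0 ∨ ∃ i' < i, s'.rvar 1 = |s.rarr 0 (j * n + i')|))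
      0 n 23 _ ?_ ?_ ?_ ?_ (Nat.zero_le _)).mono ?_
    · rintro i s₂ hi ⟨g₁, g₂, g₃, g₄, g₅, g₆, g₇, g₈⟩ hx₂ hy₂
      simp only [iVar, nVar] at hx₂ hy₂
      have key : ∀ a : ℝ, s₂.rvar 1 ≤ a → a = |s.rarr 0 (j * n + i)| →
          0 ≤ a ∧ (∀ i' < i + 1, |s.rarr 0 (j * n + i')| ≤ a) ∧
          (a = 0 ∨ ∃ i' < i + 1, a = |s.rarr 0 (j * n + i')|) := by
        intro a ha ha'
        refine ⟨by linarith, fun i' hi' => ?_, Or.inr ⟨i, by omega, ha'⟩⟩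
        obtain hi' | rfl : i' < i ∨ i' = i := by omega
        · exact (g₇ i' hi').trans ha
        · exact ha'.ge
      simp only [runs_seq, runs_ite, runs_rset, runs_iset, runs_skip, incr, Test.holds,
        RExpr.eval, IExpr.eval, accVar, yArr, kVar, g₁, g₅]
      refine ⟨fun h => ?_, fun h => ⟨fun h' => ?_, fun h' => ?_⟩⟩
      · refine ⟨by simp, ⟨trivial, g₂, by simpa using g₃, by simpa using g₄, by simp; ring, ?_⟩,
          by simp [hx₂], by simp [hy₂]⟩
        rw [Function.update_self]
        exact key _ h.le (abs_of_nonneg (g₆.trans h.le)).symm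
      · refine ⟨by simp, ⟨trivial, g₂, by simpa using g₃, by simpa using g₄, by simp; ring, ?_⟩,
          by simp [hx₂], by simp [hy₂]⟩
        rw [Function.update_self]
        exact key _ h'.le (abs_of_nonpos (by linarith)).symm
      · refine ⟨by simp, ⟨trivial, g₂, by simpa using g₃, by simpa using g₄, by simp; ring, g₆,
          fun i' hi' => ?_, ?_⟩, by simp [hx₂], by simp [hy₂]⟩
        · obtain hi' | rfl : i' < i ∨ i' = i := by omega
          · exact g₇ i' hi'
          · exact abs_le.2 ⟨by linarith, by linarith⟩
        · exact g₈.imp_right fun ⟨i', hi', e⟩ => ⟨i', by omega, e⟩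
    · simp [h₁, h₃, hx, hy]
    · simp
    · simpa using h₂
    · rintro t s₂ ⟨ht, ⟨g₁, g₂, g₃, g₄, g₅, g₆, g₇, g₈⟩, g₉, g₁₀⟩
      simp only [nVar, iVar] at g₉ g₁₀
      simp only [runs_rput, incr, runs_iset]
      refine ⟨by simp; omega, ⟨by simpa using g₁, by simpa using g₁₀, by simp [g₅]; ring,
        fun j' hj' => ?_⟩, by simp [g₄], by simp [g₃]⟩
      simp only [vArr, jVar, accVar, IExpr.eval, RExpr.eval, Function.update_self, g₂, g₄,
        Function.update_apply]
      split_ifs with hjj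
      · subst hjj
        refine le_antisymm ?_ ?_
        · obtain e | ⟨i', hi', e⟩ := g₈
          · rw [e]; exact norm_nonneg _
          · rw [e, hY ⟨i', hi'⟩ j']
            exact norm_le_pi_norm (fun i => Y i j') ⟨i', hi'⟩
        · refine (pi_norm_le_iff_of_nonneg g₆).2 fun i => ?_
          rw [Real.norm_eq_abs, ← hY i j']
          exact g₇ i i.2
      · exact h₄ j' (by omega)
  · simp [hsn]
  · simp
  · simpa using hsm
  · rintro t s' ⟨ht, ⟨h₁, h₂, h₃, h₄⟩, -⟩
    refine ⟨?_, fun j => h₄ j j.2⟩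
    simp only [IExpr.cost, Nat.sub_zero] at *
    nlinarith [Nat.mul_le_mul hn hm, Nat.mul_le_mul_right m hn]

/-- Clipping to the interval `[-a, a]`. -/
noncomputable def clip (a y : ℝ) : ℝ := if a < y then a else if y < -a then -a else y

theorem abs_clip_le {a : ℝ} (ha : 0 ≤ a) (y : ℝ) : |clip a y| ≤ a := by
  unfold clip
  split_ifs with h₁ h₂
  · rw [abs_of_nonneg ha]
  · rw [abs_neg, abs_of_nonneg ha]
  · exact abs_le.2 ⟨not_lt.1 h₂, not_lt.1 h₁⟩

theorem abs_clip_sub_le {a y z : ℝ} (hz : |z| ≤ a) : |clip a y - y| ≤ |z - y| := by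
  rw [abs_le] at hz
  unfold clip
  split_ifs with h₁ h₂
  · rw [abs_of_neg (by linarith), abs_of_nonpos (by linarith)]; linarith
  · rw [abs_of_pos (by linarith), abs_of_nonneg (by linarith)]; linarith
  · simp

theorem isProj_clip {n : ℕ} {a : ℝ} (ha : 0 ≤ a) (y : EuclideanSpace ℝ (Fin n)) :
    IsProj (linfBall n a) y (WithLp.toLp 2 fun i => clip a (y i)) := by
  refine ⟨(pi_norm_le_iff_of_nonneg ha).2 fun i => abs_clip_le ha (y i), fun z hz => ?_⟩
  refine (pow_le_pow_iff_left₀ (norm_nonneg _) (norm_nonneg _) two_ne_zero).1 ?_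
  simp only [EuclideanSpace.norm_sq_eq, Real.norm_eq_abs, PiLp.sub_apply]
  refine Finset.sum_le_sum fun i _ => pow_le_pow_left₀ (abs_nonneg _) ?_ 2
  exact abs_clip_sub_le ((pi_norm_le_iff_of_nonneg ha).1 hz i)

theorem runs_clipStage (s : Store) {n m : ℕ} (Y : Matrix (Fin n) (Fin m) ℝ)
    (u : EuclideanSpace ℝ (Fin m)) (hn : 0 < n) (hm : 0 < m) (hu : ∀ j, 0 ≤ u j)
    (hsn : s.ivar nVar = n) (hsm : s.ivar mVar = m) (hY : HoldsMat s yArr Y)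
    (hsu : HoldsVec s uArr u) :
    Runs clipStage s (fun t s' => t ≤ 60 * (n * m) ∧ ∃ X : Matrix (Fin n) (Fin m) ℝ,
      HoldsMat s' xArr X ∧ ∀ j, IsProj (linfBall n (u j)) (column Y j) (column X j)) := by
  simp only [nVar, mVar, yArr, uArr] at hsn hsm hY hsu
  unfold clipStage
  simp only [runs_seq, runs_iset]
  refine (runs_for (fun j s' => s'.rarr 0 = s.rarr 0 ∧ s'.rarr 2 = s.rarr 2 ∧ s'.ivar 0 = n ∧
      s'.ivar 4 = j * n ∧ ∀ j' < j, ∀ i' < n,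
        s'.rarr 3 (j' * n + i') = clip (s.rarr 2 j') (s.rarr 0 (j' * n + i')))
    0 m (27 * n + 15) _ ?_ ?_ ?_ ?_ (Nat.zero_le _)).mono ?_
  · rintro j s₁ hj ⟨h₁, h₂, h₃, h₄, h₅⟩ hx hy
    simp only [jVar, mVar] at hx hy
    simp only [runs_seq, runs_iset, runs_rset]
    refine (runs_for (fun i s' => s'.rarr 0 = s.rarr 0 ∧ s'.rarr 2 = s.rarr 2 ∧
        s'.ivar 1 = m ∧ s'.ivar 3 = j ∧ s'.ivar 4 = j * n + i ∧ s'.rvar 1 = s.rarr 2 j ∧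
        (∀ j' < j, ∀ i' < n,
          s'.rarr 3 (j' * n + i') = clip (s.rarr 2 j') (s.rarr 0 (j' * n + i'))) ∧
        ∀ i' < i, s'.rarr 3 (j * n + i') = clip (s.rarr 2 j) (s.rarr 0 (j * n + i')))
      0 n 23 _ ?_ ?_ ?_ ?_ (Nat.zero_le _)).mono ?_
    · rintro i s₂ hi ⟨g₁, g₂, g₃, g₄, g₅, g₆, g₇, g₈⟩ hx₂ hy₂
      simp only [iVar, nVar] at hx₂ hy₂
      have key : ∀ a : ℝ, a = clip (s.rarr 2 j) (s.rarr 0 (j * n + i)) →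
          (∀ j' < j, ∀ i' < n, Function.update (s₂.rarr 3) (j * n + i) a (j' * n + i') =
            clip (s.rarr 2 j') (s.rarr 0 (j' * n + i'))) ∧
          ∀ i' < i + 1, Function.update (s₂.rarr 3) (j * n + i) a (j * n + i') =
            clip (s.rarr 2 j) (s.rarr 0 (j * n + i')) := by
        intro a ha
        refine ⟨fun j' hj' i' hi' => ?_, fun i' hi' => ?_⟩
        -- Addresses in earlier columns are below `j * n`, so the current write does not touch them.
        · have : (j' + 1) * n ≤ j * n := Nat.mul_le_mul_right _ hj'
          rw [Function.update_of_ne (by nlinarith), g₇ j' hj' i' hi']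
        · rw [Function.update_apply]
          split_ifs with hii
          · rw [ha, hii]
          · exact g₈ i' (by omega)
      simp only [runs_seq, runs_ite, runs_rput, runs_iset, incr, Test.holds,
        RExpr.eval, IExpr.eval, accVar, yArr, kVar, xArr, g₁, g₅, g₆]
      refine ⟨fun h => ?_, fun h => ⟨fun h' => ?_, fun h' => ?_⟩⟩
      all_goals
        refine ⟨by simp, ⟨by simp [g₁], by simp [g₂], by simpa using g₃, by simpa using g₄,
          by simp; ring, trivial, ?_⟩, by simp [hx₂], by simp [hy₂]⟩
        simp only [Function.update_self]
        refine key _ ?_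
      · rw [clip, if_pos h]
      · rw [clip, if_neg h, if_pos h']
      · rw [clip, if_neg h, if_neg h']
    · simpa [h₁, h₂, h₄, hx, hy] using h₅
    · simp
    · simpa using h₃
    · rintro t s₂ ⟨ht, ⟨g₁, g₂, g₃, g₄, g₅, g₆, g₇, g₈⟩, g₉, g₁₀⟩
      simp only [nVar, iVar] at g₉ g₁₀
      simp only [incr, runs_iset]
      refine ⟨by simp; omega, ⟨g₁, g₂, by simpa using g₁₀, by simp [g₅]; ring,
        fun j' hj' i' hi' => ?_⟩, by simp [g₄], by simp [g₃]⟩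
      obtain hj' | rfl : j' < j ∨ j' = j := by omega
      · exact g₇ j' hj' i' hi'
      · exact g₈ i' hi'
  · simp [hsn]
  · simp
  · simpa using hsm
  · rintro t s' ⟨ht, ⟨h₁, h₂, h₃, h₄, h₅⟩, -⟩
    refine ⟨?_, Matrix.of fun i j => clip (u j) (Y i j), fun i j => ?_, fun j => ?_⟩
    · simp only [IExpr.cost, Nat.sub_zero] at *
      nlinarith [Nat.mul_le_mul hn hm, Nat.mul_le_mul_right m hn]
    · rw [h₅ j j.2 i i.2, hsu j, hY i j]; rfl
    · exact isProj_clip (hu j) (column Y j)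

/-! ### Uniqueness of the projections -/

/-- By the parallelogram law, two distinct minimisers would have a midpoint strictly closer to `y`,
and convexity keeps the midpoint in `S`. -/
theorem IsProj.unique {d : ℕ} {S : Set (EuclideanSpace ℝ (Fin d))}
    {y x x' : EuclideanSpace ℝ (Fin d)} (hS : Convex ℝ S) (h : IsProj S y x)
    (h' : IsProj S y x') : x = x' := by
  have hr : ‖x' - y‖ = ‖x - y‖ := le_antisymm (h'.2 x h.1) (h.2 x' h'.1)
  have hm := h.2 _ (hS h.1 h'.1 (a := 1 / 2) (b := 1 / 2) (by norm_num) (by norm_num)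
    (by norm_num))
  have hp := parallelogram_law_with_norm ℝ (x - y) (x' - y)
  have e : (x - y) + (x' - y) = (2 : ℝ) • ((1 / 2 : ℝ) • x + (1 / 2 : ℝ) • x' - y) := by
    module
  rw [e, norm_smul, hr, sub_sub_sub_cancel_right, Real.norm_ofNat] at hp
  have h0 : ‖x - x'‖ = 0 := by
    have := norm_nonneg (x - y)
    have := norm_nonneg (x - x')
    nlinarith
  exact sub_eq_zero.1 (norm_eq_zero.1 h0)

theorem convex_l1Ball (d : ℕ) (η : ℝ) : Convex ℝ (l1Ball d η) := by
  intro x hx y hy a b ha hb hab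
  have hx' : ∑ j, |x j| ≤ η := hx
  have hy' : ∑ j, |y j| ≤ η := hy
  change ∑ j, |(a • x + b • y) j| ≤ η
  calc ∑ j, |(a • x + b • y) j| ≤ ∑ j, (a * |x j| + b * |y j|) := by
        refine Finset.sum_le_sum fun j _ => ?_
        simp only [PiLp.add_apply, PiLp.smul_apply, smul_eq_mul]
        refine (abs_add_le _ _).trans ?_
        rw [abs_mul, abs_mul, abs_of_nonneg ha, abs_of_nonneg hb]
    _ = a * ∑ j, |x j| + b * ∑ j, |y j| := by
        rw [Finset.sum_add_distrib, Finset.mul_sum, Finset.mul_sum]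
    _ ≤ a * η + b * η := by gcongr
    _ = η := by rw [← add_mul, hab, one_mul]

theorem convex_linfBall (d : ℕ) (r : ℝ) : Convex ℝ (linfBall d r) := by
  intro x hx y hy a b ha hb hab
  have hx' : ‖(fun i => x i : Fin d → ℝ)‖ ≤ r := hx
  have hy' : ‖(fun i => y i : Fin d → ℝ)‖ ≤ r := hy
  change ‖a • (fun i => x i : Fin d → ℝ) + b • (fun i => y i : Fin d → ℝ)‖ ≤ r
  refine (norm_add_le _ _).trans ?_
  rw [norm_smul, norm_smul, Real.norm_of_nonneg ha, Real.norm_of_nonneg hb]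
  calc _ ≤ a * r + b * r := by gcongr
    _ = r := by rw [← add_mul, hab, one_mul]

/-- The projection of a nonnegative vector onto the `ℓ₁` ball is nonnegative. -/
theorem IsProj.nonneg {d : ℕ} {η : ℝ} {v u : EuclideanSpace ℝ (Fin d)}
    (h : IsProj (l1Ball d η) v u) (hv : ∀ j, 0 ≤ v j) (j : Fin d) : 0 ≤ u j := by
  -- Taking absolute values keeps `u` in the ball and brings it no farther from `v ≥ 0`; uniqueness
  -- then forces `u = |u|`.
  have h' : IsProj (l1Ball d η) v (WithLp.toLp 2 fun j => |u j|) := by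
    refine ⟨?_, fun z hz => le_trans ?_ (h.2 z hz)⟩
    · have : ∑ j, |u j| ≤ η := h.1
      simpa [l1Ball] using this
    · refine (pow_le_pow_iff_left₀ (norm_nonneg _) (norm_nonneg _) two_ne_zero).1 ?_
      simp only [EuclideanSpace.norm_sq_eq, Real.norm_eq_abs, PiLp.sub_apply]
      refine Finset.sum_le_sum fun j _ => pow_le_pow_left₀ (abs_nonneg _) ?_ 2
      rw [← abs_of_nonneg (hv j)]
      exact (abs_abs_sub_abs_le_abs_sub _ _).trans (by rw [abs_of_nonneg (hv j)])
  rw [h.unique (convex_l1Ball d η) h']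
  exact abs_nonneg _

theorem bilevelProj_eq_singleton {n m : ℕ} {η : ℝ} {Y X : Matrix (Fin n) (Fin m) ℝ}
    {u : EuclideanSpace ℝ (Fin m)} (hu : IsProj (l1Ball m η) (colNorms Y) u)
    (hX : ∀ j, IsProj (linfBall n (u j)) (column Y j) (column X j)) : bilevelProj η Y = {X} := by
  ext X'
  rw [Set.mem_singleton_iff]
  constructor
  · rintro ⟨u', hu', hX'⟩
    obtain rfl := hu'.unique (convex_l1Ball m η) hu
    ext i j
    have := (hX' j).unique (convex_linfBall n _) (hX j)
    exact congrArg (fun x : EuclideanSpace ℝ (Fin n) => x i) this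
  · rintro rfl
    exact ⟨u, hu, hX⟩

/-! ### The whole algorithm -/

theorem runs_bilevelAlg (s : Store) {n m : ℕ} {η : ℝ} (Y : Matrix (Fin n) (Fin m) ℝ) (hn : 0 < n)
    (hm : 0 < m) (hη0 : 0 ≤ η) (hsn : s.ivar nVar = n) (hsm : s.ivar mVar = m)
    (hη : s.rvar etaVar = η) (hY : HoldsMat s yArr Y) :
    Runs (bilevelAlg l1Cmd) s (fun t s' => t ≤ 10 * (pivotConst + 100) * (n * m) ∧
      ∃ X : Matrix (Fin n) (Fin m) ℝ, HoldsMat s' xArr X ∧ bilevelProj η Y = {X}) := by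
  unfold bilevelAlg
  rw [runs_seq]
  refine (runs_normStage s Y hn hm hsn hsm hY).frame.mono ?_
  rintro t₁ s₁ ⟨⟨ht₁, h₁⟩, hf₁⟩
  have hsm₁ : s₁.ivar mVar = m := (hf₁.ivar _ (by decide)).trans hsm
  rw [runs_seq]
  refine (runs_l1 s₁ (colNorms Y) hm hη0 hsm₁ ((hf₁.rvar _ (by decide)).trans hη) h₁).frame.mono ?_
  rintro t₂ s₂ ⟨⟨ht₂, u, h₂, hu⟩, hf₂⟩
  have hy₂ : s₂.rarr yArr = s.rarr yArr :=
    (hf₂.rarr _ (by decide)).trans (hf₁.rarr _ (by decide))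
  -- Clipping needs nonnegative radii; they come from projecting the nonnegative vector of column
  -- norms.
  refine (runs_clipStage s₂ Y u hn hm (hu.nonneg fun j => norm_nonneg _)
    ((hf₂.ivar _ (by decide)).trans ((hf₁.ivar _ (by decide)).trans hsn))
    ((hf₂.ivar _ (by decide)).trans hsm₁) (fun i j => by rw [hy₂]; exact hY i j) h₂).mono ?_
  rintro t₃ s₃ ⟨ht₃, X, hX, hX'⟩
  refine ⟨?_, X, hX, bilevelProj_eq_singleton hu hX'⟩
  have := Nat.mul_le_mul_left (9 * (pivotConst + 100)) (Nat.le_mul_of_pos_left m hn)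
  simp only [pivotConst] at *
  omega

end BilevelProj

theorem mainTheorem5 :
    ∃ (P : List Cmd) (l1 : Cmd) (C : ℕ),
      -- the column norms are computed in time `O(nm)`
      (∀ (n m : ℕ) (Y : Matrix (Fin n) (Fin m) ℝ) (s : Store), 0 < n → 0 < m →
        s.ivar nVar = n → s.ivar mVar = m → HoldsMat s yArr Y →
        ∃ (t : ℕ) (s' : Store), Exec P normStage s t s' ∧ t ≤ C * (n * m) ∧
          HoldsVec s' vArr (colNorms Y)) ∧
      -- the `ℓ₁` projection of a vector of length `m` is computed in time `O(m)`
      (∀ (m : ℕ) (η : ℝ) (v : EuclideanSpace ℝ (Fin m)) (s : Store), 0 < m → 0 ≤ η →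
        s.ivar mVar = m → s.rvar etaVar = η → HoldsVec s vArr v →
        ∃ (t : ℕ) (s' : Store), Exec P l1 s t s' ∧ t ≤ C * m ∧
          ∃ u, HoldsVec s' uArr u ∧ IsProj (l1Ball m η) v u) ∧
      -- the columnwise clipping computes the `ℓ_∞` projections of the columns in time `O(nm)`
      (∀ (n m : ℕ) (Y : Matrix (Fin n) (Fin m) ℝ) (u : EuclideanSpace ℝ (Fin m)) (s : Store),
        0 < n → 0 < m → (∀ j, 0 ≤ u j) →
        s.ivar nVar = n → s.ivar mVar = m → HoldsMat s yArr Y → HoldsVec s uArr u →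
        ∃ (t : ℕ) (s' : Store), Exec P clipStage s t s' ∧ t ≤ C * (n * m) ∧
          ∃ X : Matrix (Fin n) (Fin m) ℝ, HoldsMat s' xArr X ∧
            ∀ j, IsProj (linfBall n (u j)) (column Y j) (column X j)) ∧
      -- the whole algorithm computes the bilevel projection exactly, in time `O(nm)`
      (∀ (n m : ℕ) (η : ℝ) (Y : Matrix (Fin n) (Fin m) ℝ) (s : Store),
        0 < n → 0 < m → 0 ≤ η →
        s.ivar nVar = n → s.ivar mVar = m → s.rvar etaVar = η → HoldsMat s yArr Y →
        ∃ (t : ℕ) (s' : Store), Exec P (bilevelAlg l1) s t s' ∧ t ≤ C * (n * m) ∧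
          ∃ X : Matrix (Fin n) (Fin m) ℝ, HoldsMat s' xArr X ∧ bilevelProj η Y = {X}) := by
  -- The pivot search is iterative, so no procedures are needed.
  refine ⟨[], l1Cmd, 10 * (pivotConst + 100), ?_, ?_, ?_, ?_⟩
  · intro n m Y s hn hm hsn hsm hY
    obtain ⟨t, s', he, ht, h⟩ := runs_normStage s Y hn hm hsn hsm hY
    exact ⟨t, s', he, ht.trans (Nat.mul_le_mul_right _ (by simp [pivotConst])), h⟩
  · intro m η v s hm hη0 hsm hη hv
    obtain ⟨t, s', he, ht, h⟩ := runs_l1 s v hm hη0 hsm hη hv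
    exact ⟨t, s', he, ht.trans (Nat.mul_le_mul_right _ (by simp [pivotConst])), h⟩
  · intro n m Y u s hn hm hu hsn hsm hY hsu
    obtain ⟨t, s', he, ht, h⟩ := runs_clipStage s Y u hn hm hu hsn hsm hY hsu
    exact ⟨t, s', he, ht.trans (Nat.mul_le_mul_right _ (by simp [pivotConst])), h⟩
  · intro n m η Y s hn hm hη0 hsn hsm hη hY
    exact runs_bilevelAlg s Y hn hm hη0 hsn hsm hη hY
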